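/- Let $n\ge 1$ and $\Omega=(0,1)^n$. For $1\le p\le u<\infty$, let $\mathcal M^u_p(\Omega)$ be the space of all complex-valued $f\in L_p^{loc}(\Omega)$ (modulo equality a.e.) with $$\|f\|_{\mathcal M^u_p(\Omega)}:=\sup_{x\in\Omega}\sup_{r>0}|B(x,r)\cap\Omega|^{\frac1u-\frac1p}\Big(\int_{B(x,r)\cap\Omega}|f(y)|^p\,dy\Big)^{1/p}<\infty ,$$ where $B(x,r)$ is the Euclidean ball, and let $\overset{\diamond}{\mathcal M}{}^u_p(\Omega)$ (the $\diamond$-closure) be the closure in $\mathcal M^u_p(\Omega)$, with the norm of $\mathcal M^u_p(\Omega)$, of the set of all infinitely differentiable functions $f$ on $\Omega$ such that $D^\alpha f\in\mathcal M^u_p(\Omega)$ for all multi-indices $\alpha$. For a couple $(X_0,X_1)$ of Banach spaces continuously embedded in a common Hausdorff topological vector space and $\Theta\in(0,1)$, the Peetre–Gagliardo space $\langle X_0,X_1\rangle_\Theta$ is the set of all $a\in X_0+X_1$ for which there are a sequence $(a_i)_{i\in\mathbb Z}$ in $X_0\cap X_1$ with $a=\sum_{i\in\mathbb Z}a_i$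 in $X_0+X_1$ and a constant $C\ge 0$ such that, for $j\in\{0,1\}$ and every bounded sequence $(\varepsilon_i)_{i\in\mathbb Z}$ in $\mathbb C$, the series $\sum_{i\in\mathbb Z}\varepsilon_i2^{i(j-\Theta)}a_i$ converges in $X_j$ and $$\Big\|\sum_{i\in\mathbb Z}\varepsilon_i2^{i(j-\Theta)}a_i\Big\|_{X_j}\le C\sup_{i\in\mathbb Z}|\varepsilon_i| .$$ Its norm $\|a\|_{\langle X_0,X_1\rangle_\Theta}$ is the infimum of all such constants $C$ (over all such sequences). **Theorem.** Let $\Theta\in(0,1)$, $1\le p_0\le u_0<\infty$, $1\le p_1\le u_1<\infty$, $p_0u_1=p_1u_0$, and assume that $p_0\ne p_1$ or $p_0=u_0$. Let $$\frac1u:=\frac{1-\Theta}{u_0}+\frac{\Theta}{u_1},\qquad \frac1p:=\frac{1-\Theta}{p_0}+\frac{\Theta}{p_1}.$$ Then $$\big\langle\mathcal M^{u_0}_{p_0}((0,1)^n),\mathcal M^{u_1}_{p_1}((0,1)^n)\big\rangle_\Theta=\overset{\diamond}{\mathcal M}{}^u_p((0,1)^n)$$ as sets, with equivalence of norms: there are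 constants $c,C>0$ with $c\,\|f\|_{\mathcal M^u_p((0,1)^n)}\le\|f\|_{\langle\mathcal M^{u_0}_{p_0}((0,1)^n),\mathcal M^{u_1}_{p_1}((0,1)^n)\rangle_\Theta}\le C\,\|f\|_{\mathcal M^u_p((0,1)^n)}$ for all $f\in\overset{\diamond}{\mathcal M}{}^u_p((0,1)^n)$. -/

import Mathlib

open MeasureTheory Filter Topology
open scoped ENNReal NNReal

noncomputable section

/-! ### The Peetre–Gagliardo interpolation method

Normed spaces inside a complex vector space `Y` are described by extended norms
`N : Y → ℝ≥0∞`: the space is `{x | N x < ∞}`, and convergence in it is convergence with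
respect to `N`.  A couple `(X₀, X₁)` is a family `N : Fin 2 → Y → ℝ≥0∞`. -/

section Interpolation

variable {Y : Type*} [AddCommGroup Y] [Module ℂ Y]

/-- The norm of `X₀ + X₁`: the infimum of `‖h₀‖_{X₀} + ‖h₁‖_{X₁}` over all `h = h₀ + h₁`.
It is finite exactly on `X₀ + X₁`. -/
def sumENorm (N : Fin 2 → Y → ℝ≥0∞) (h : Y) : ℝ≥0∞ :=
  ⨅ (h₀ : Y) (h₁ : Y) (_ : h = h₀ + h₁), N 0 h₀ + N 1 h₁

/-- The series `∑_{i ∈ ℤ} x i` converges (unconditionally) to `s` in the space `{N < ∞}`. -/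
def SeriesConvergesTo (N : Y → ℝ≥0∞) (x : ℤ → Y) (s : Y) : Prop :=
  N s < ∞ ∧ Tendsto (fun F : Finset ℤ => N (s - ∑ i ∈ F, x i)) atTop (𝓝 0)

/-- The sequence `x` in `X₀ ∩ X₁` represents `a` in the Peetre–Gagliardo method with
parameter `Θ` and constant `C`: `a = ∑ x i` in `X₀ + X₁`, and, for every bounded complex
sequence `ε` and `j ∈ {0, 1}`, the series `∑ ε i 2^{i (j - Θ)} x i` converges in `X_j` to an
element of norm at most `C sup |ε i|`. -/
def IsPeetreGagliardoRepr (N : Fin 2 → Y → ℝ≥0∞) (Θ : ℝ) (a : Y) (x : ℤ → Y) (C : ℝ≥0) : Prop :=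
  (∀ i j, N j (x i) < ∞) ∧
  SeriesConvergesTo (sumENorm N) x a ∧
  ∀ ε : ℤ → ℂ, (⨆ i, ‖ε i‖ₑ) < ∞ → ∀ j : Fin 2, ∃ s : Y,
    SeriesConvergesTo (N j)
      (fun i => (ε i * (((2 : ℝ) ^ ((i : ℝ) * (((j : ℕ) : ℝ) - Θ)) : ℝ) : ℂ)) • x i) s ∧
    N j s ≤ C * ⨆ i, ‖ε i‖ₑ

/-- The interpolation space `⟨X₀, X₁⟩_Θ`, as a set. -/
def peetreGagliardo (N : Fin 2 → Y → ℝ≥0∞) (Θ : ℝ) : Set Y :=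
  {a | ∃ (x : ℤ → Y) (C : ℝ≥0), IsPeetreGagliardoRepr N Θ a x C}

/-- The norm of `⟨X₀, X₁⟩_Θ`: the infimum of all admissible constants. -/
def peetreGagliardoENorm (N : Fin 2 → Y → ℝ≥0∞) (Θ : ℝ) (a : Y) : ℝ≥0∞ :=
  ⨅ (x : ℤ → Y) (C : ℝ≥0) (_ : IsPeetreGagliardoRepr N Θ a x C), (C : ℝ≥0∞)

/-- The closure of `S` in the space `{N < ∞}` (for `S ⊆ {N < ∞}`). -/
def closureIn (N : Y → ℝ≥0∞) (S : Set Y) : Set Y :=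
  {f | N f < ∞ ∧ ∀ δ : ℝ≥0∞, 0 < δ → ∃ g ∈ S, N (f - g) < δ}

end Interpolation

/-! ### Morrey spaces on a bounded domain and their diamond closure -/

section Morrey

variable {n : ℕ}

/-- The Morrey norm
`sup_{x ∈ Ω} sup_{r > 0} |B(x,r) ∩ Ω|^{1/u - 1/p} (∫_{B(x,r) ∩ Ω} |f|^p)^{1/p}`. -/
def morreyFunENorm (Ω : Set (EuclideanSpace ℝ (Fin n))) (u p : ℝ)
    (f : EuclideanSpace ℝ (Fin n) → ℂ) : ℝ≥0∞ :=
  ⨆ (x ∈ Ω) (r : ℝ) (_ : 0 < r),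
    volume (Metric.ball x r ∩ Ω) ^ (1 / u - 1 / p) *
      (∫⁻ y in Metric.ball x r ∩ Ω, ‖f y‖ₑ ^ p) ^ (1 / p)

/-- The Morrey norm on classes of a.e. equal measurable functions on `Ω`.  The Morrey space
is the set of classes where it is finite; for a bounded nonempty open `Ω`, this already
forces `∫_Ω |f|^p < ∞` (take `r` larger than the diameter), so local `p`-integrability is not
a separate condition. -/
def morreyENorm (Ω : Set (EuclideanSpace ℝ (Fin n))) (u p : ℝ)
    (f : EuclideanSpace ℝ (Fin n) →ₘ[volume.restrict Ω] ℂ) : ℝ≥0∞ :=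
  morreyFunENorm Ω u p f

/-- The partial derivative `∂_{w 0} ⋯ ∂_{w (k-1)} g` of order `k`.  As `k` and `w` vary, these
are, for smooth `g`, exactly the derivatives `D^α g` with `α` a multi-index. -/
def iteratedPartial {k : ℕ} (w : Fin k → Fin n) (g : EuclideanSpace ℝ (Fin n) → ℂ)
    (y : EuclideanSpace ℝ (Fin n)) : ℂ :=
  iteratedFDeriv ℝ k g y (fun l => EuclideanSpace.single (w l) (1 : ℝ))

/-- The (classes of) functions that are infinitely differentiable on the open set `Ω` and have
all their derivatives, of order zero included, in the Morrey space on `Ω`. -/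
def smoothMorrey (Ω : Set (EuclideanSpace ℝ (Fin n))) (u p : ℝ) :
    Set (EuclideanSpace ℝ (Fin n) →ₘ[volume.restrict Ω] ℂ) :=
  {f | ∃ g : EuclideanSpace ℝ (Fin n) → ℂ, ContDiffOn ℝ ((⊤ : ℕ∞) : WithTop ℕ∞) g Ω ∧
    (⇑f =ᵐ[volume.restrict Ω] g) ∧
    ∀ (k : ℕ) (w : Fin k → Fin n), morreyFunENorm Ω u p (iteratedPartial w g) < ∞}

/-- The diamond closure of the Morrey space: the closure, in the Morrey space, of the smooth
functions all of whose derivatives belong to the Morrey space. -/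
def diamondMorrey (Ω : Set (EuclideanSpace ℝ (Fin n))) (u p : ℝ) :
    Set (EuclideanSpace ℝ (Fin n) →ₘ[volume.restrict Ω] ℂ) :=
  closureIn (morreyENorm Ω u p) (smoothMorrey Ω u p)

/-- The open unit cube `(0,1)^n`. -/
def unitCube (n : ℕ) : Set (EuclideanSpace ℝ (Fin n)) :=
  {x | ∀ i, 0 < x i ∧ x i < 1}

end Morrey

end

/-! All spaces involved have the same density `p₀ / u₀ = p₁ / u₁ = p / u`. Raised to the power `p`,
the Morrey condition reads `|B ∩ Ω| ^ (p/u - 1) * ∫ |f|^p ≤ D^p`, with one and the same volume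
factor in the three spaces. Hence powers (`morreyLENorm_rpow_le`) and Hölder's inequality
(`morreyLENorm_mul_rpow_le`) act ball by ball as in Lebesgue spaces.

From the interpolation space to the Morrey space: choosing `ε` to be the indicator of a finite set
bounds all weighted partial sums of a representation. Averaging over subsets then bounds the maximal
functions `sup_i 2^{i(j-Θ)} |x i|` in the two end spaces (`morreyLENorm_finset_sup_le`). Pointwise,
`∑ |x i|` is at most a constant times the product of the two maximal functions with exponents `1 -
Θ` and `Θ`, so Hölder controls finite sums in the middle space. Fatou's lemma identifies the limit,
and unconditional convergence makes the tails small (`exists_morreyENorm_le_of_repr`). Thus `a` is a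
limit of elements of the intersection of the end spaces. Such elements are limits of bounded
functions: if `p₀ ≠ p₁`, they have integrability better than `p`; otherwise the middle space is
`L_p`.

Conversely, a limit `f` of bounded functions is cut into the pieces on which `|f|^{p/p₁ - p/p₀}` is
comparable to `2^i`, after normalising the height. On such a piece `2^{i(j-Θ)} |f|` is bounded by a
multiple of `|f|^{p/p_j}`, whose norm in the `j`-th space is a power of the norm of `f`. The pieces
are disjoint, so bounded coefficients do no harm. The tails live where `|f|` is very large or very
small, and vanish in the limit exactly because `f` is approximable by bounded functions
(`isPeetreGagliardoRepr_levelPart`).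

Finally, the diamond closure is the closure of the bounded functions: smooth functions with
integrable derivatives are bounded, and mollification approximates bounded functions
(`diamondMorrey_eq_closureIn_boundedFun`). -/

noncomputable section

/-! ### The Morrey functional on nonnegative functions -/

section MorreyFunctional

variable {n : ℕ}

/-- The Morrey functional of the unit cube on `ℝ≥0∞`-valued functions. -/
def morreyLENorm (u p : ℝ) (φ : EuclideanSpace ℝ (Fin n) → ℝ≥0∞) : ℝ≥0∞ :=
  ⨆ (x ∈ unitCube n) (r : ℝ) (_ : 0 < r),
    volume (Metric.ball x r ∩ unitCube n) ^ (1 / u - 1 / p) *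
      (∫⁻ y in Metric.ball x r ∩ unitCube n, φ y ^ p) ^ (1 / p)

lemma isOpen_unitCube : IsOpen (unitCube n) := by
  have : unitCube n = ⋂ i, {x : EuclideanSpace ℝ (Fin n) | 0 < x i ∧ x i < 1} := by
    ext x; simp [unitCube]
  rw [this]
  refine isOpen_iInter_of_finite fun i => ?_
  have hc : Continuous fun x : EuclideanSpace ℝ (Fin n) => x i := by fun_prop
  exact (isOpen_lt continuous_const hc).inter (isOpen_lt hc continuous_const)

lemma measurableSet_unitCube : MeasurableSet (unitCube n) := isOpen_unitCube.measurableSet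

lemma unitCube_eq_preimage :
    unitCube n = WithLp.ofLp ⁻¹' (Set.univ.pi fun _ : Fin n => Set.Ioo (0 : ℝ) 1) := by
  ext x; simp [unitCube, Set.mem_pi]

lemma volume_unitCube : volume (unitCube n) = 1 := by
  rw [unitCube_eq_preimage, (PiLp.volume_preserving_ofLp (Fin n)).measure_preimage
    (MeasurableSet.univ_pi fun _ => measurableSet_Ioo).nullMeasurableSet, volume_pi_pi]
  simp

instance : IsProbabilityMeasure (volume.restrict (unitCube n)) :=
  ⟨by simp [volume_unitCube]⟩

lemma volume_ball_inter_unitCube_le (x : EuclideanSpace ℝ (Fin n)) (r : ℝ) :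
    volume (Metric.ball x r ∩ unitCube n) ≤ 1 :=
  (measure_mono Set.inter_subset_right).trans_eq volume_unitCube

lemma volume_ball_inter_unitCube_ne_zero {x : EuclideanSpace ℝ (Fin n)} (hx : x ∈ unitCube n)
    {r : ℝ} (hr : 0 < r) : volume (Metric.ball x r ∩ unitCube n) ≠ 0 :=
  ((Metric.isOpen_ball.inter isOpen_unitCube).measure_pos _
    ⟨x, Metric.mem_ball_self hr, hx⟩).ne'

lemma volume_ball_inter_unitCube_ne_top (x : EuclideanSpace ℝ (Fin n)) (r : ℝ) :
    volume (Metric.ball x r ∩ unitCube n) ≠ ∞ :=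
  ((volume_ball_inter_unitCube_le x r).trans_lt ENNReal.one_lt_top).ne

lemma half_mem_unitCube : WithLp.toLp 2 (fun _ => (1 / 2 : ℝ)) ∈ unitCube n := by
  intro i; norm_num

lemma exists_ball_superset_unitCube : ∃ r : ℝ, 0 < r ∧
    Metric.ball (WithLp.toLp 2 (fun _ => (1 / 2 : ℝ))) r ∩ unitCube n = unitCube n := by
  refine ⟨√(∑ _i : Fin n, 1) + 1, by positivity, Set.inter_eq_right.2 fun y hy => ?_⟩
  rw [Metric.mem_ball, EuclideanSpace.dist_eq]
  refine (Real.sqrt_le_sqrt (Finset.sum_le_sum fun i _ => ?_)).trans_lt (lt_add_one _)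
  have := hy i
  rw [Real.dist_eq, sq_abs]
  simp only
  nlinarith

lemma morreyLENorm_le_iff {u p : ℝ} (hp : 0 < p) {φ : EuclideanSpace ℝ (Fin n) → ℝ≥0∞}
    {D : ℝ≥0∞} : morreyLENorm u p φ ≤ D ↔ ∀ x ∈ unitCube n, ∀ r : ℝ, 0 < r →
      volume (Metric.ball x r ∩ unitCube n) ^ (p / u - 1) *
        ∫⁻ y in Metric.ball x r ∩ unitCube n, φ y ^ p ≤ D ^ p := by
  simp only [morreyLENorm, iSup_le_iff]
  refine forall₄_congr fun x hx r hr => ?_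
  rw [← ENNReal.rpow_inv_le_iff hp, ← one_div, ENNReal.mul_rpow_of_nonneg _ _ (by positivity),
    ← ENNReal.rpow_mul]
  have : (p / u - 1) * (1 / p) = 1 / u - 1 / p := by field_simp
  rw [this]

lemma morreyLENorm_spec {u p : ℝ} (hp : 0 < p) (φ : EuclideanSpace ℝ (Fin n) → ℝ≥0∞)
    {x : EuclideanSpace ℝ (Fin n)} (hx : x ∈ unitCube n) {r : ℝ} (hr : 0 < r) :
    volume (Metric.ball x r ∩ unitCube n) ^ (p / u - 1) *
        ∫⁻ y in Metric.ball x r ∩ unitCube n, φ y ^ p ≤ morreyLENorm u p φ ^ p :=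
  (morreyLENorm_le_iff hp).1 le_rfl x hx r hr

lemma morreyLENorm_mono_ae {u p : ℝ} (hp : 0 < p) {φ ψ : EuclideanSpace ℝ (Fin n) → ℝ≥0∞}
    (h : ∀ᵐ y ∂volume.restrict (unitCube n), φ y ≤ ψ y) :
    morreyLENorm u p φ ≤ morreyLENorm u p ψ := by
  refine (morreyLENorm_le_iff hp).2 fun x hx r hr => le_trans ?_ (morreyLENorm_spec hp ψ hx hr)
  gcongr 1
  refine lintegral_mono_ae ?_
  filter_upwards [ae_restrict_of_ae_restrict_of_subset Set.inter_subset_right h] with y hy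
  gcongr

lemma morreyLENorm_congr_ae {u p : ℝ} (hp : 0 < p) {φ ψ : EuclideanSpace ℝ (Fin n) → ℝ≥0∞}
    (h : φ =ᵐ[volume.restrict (unitCube n)] ψ) :
    morreyLENorm u p φ = morreyLENorm u p ψ :=
  le_antisymm (morreyLENorm_mono_ae hp h.le) (morreyLENorm_mono_ae hp h.symm.le)

lemma aemeasurable_inter_ball {φ : EuclideanSpace ℝ (Fin n) → ℝ≥0∞}
    (h : AEMeasurable φ (volume.restrict (unitCube n))) (x : EuclideanSpace ℝ (Fin n)) (r : ℝ) :
    AEMeasurable φ (volume.restrict (Metric.ball x r ∩ unitCube n)) :=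
  h.mono_measure (Measure.restrict_mono Set.inter_subset_right le_rfl)

lemma morreyLENorm_add_le {u p : ℝ} (hp : 1 ≤ p) {φ ψ : EuclideanSpace ℝ (Fin n) → ℝ≥0∞}
    (hφ : AEMeasurable φ (volume.restrict (unitCube n)))
    (hψ : AEMeasurable ψ (volume.restrict (unitCube n))) :
    morreyLENorm u p (fun y => φ y + ψ y) ≤ morreyLENorm u p φ + morreyLENorm u p ψ := by
  refine iSup₂_le fun x hx => iSup₂_le fun r hr => ?_
  refine (mul_le_mul_right (ENNReal.lintegral_Lp_add_le (aemeasurable_inter_ball hφ x r)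
    (aemeasurable_inter_ball hψ x r) hp) _).trans ?_
  rw [mul_add]
  refine add_le_add ?_ ?_
  · exact le_iSup₂_of_le x hx (le_iSup₂_of_le r hr le_rfl)
  · exact le_iSup₂_of_le x hx (le_iSup₂_of_le r hr le_rfl)

lemma morreyLENorm_const_mul_le {u p : ℝ} (hp : 0 < p) (c : ℝ≥0)
    (φ : EuclideanSpace ℝ (Fin n) → ℝ≥0∞) :
    morreyLENorm u p (fun y => c * φ y) ≤ c * morreyLENorm u p φ := by
  refine (morreyLENorm_le_iff hp).2 fun x hx r hr => ?_
  have hc : (c : ℝ≥0∞) ^ p ≠ ∞ := ENNReal.rpow_ne_top_of_nonneg hp.le ENNReal.coe_ne_top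
  simp_rw [ENNReal.mul_rpow_of_nonneg _ _ hp.le]
  rw [lintegral_const_mul' _ _ hc, mul_left_comm]
  gcongr
  exact morreyLENorm_spec hp φ hx hr

/-- Equal densities give equal powers of the volume, so both sides test the same quantity on each
ball. -/
lemma morreyLENorm_rpow_le {u p v q : ℝ} (hp : 0 < p) (hq : 0 < q)
    (hκ : q / v = p / u) (φ : EuclideanSpace ℝ (Fin n) → ℝ≥0∞) :
    morreyLENorm v q (fun y => φ y ^ (p / q)) ≤ morreyLENorm u p φ ^ (p / q) := by
  refine (morreyLENorm_le_iff hq).2 fun x hx r hr => ?_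
  simp_rw [← ENNReal.rpow_mul, div_mul_cancel₀ p hq.ne', hκ]
  exact morreyLENorm_spec hp φ hx hr

/-- Hölder's inequality for Morrey functionals of the same density `p / u`. -/
lemma morreyLENorm_mul_rpow_le {u p u₀ p₀ u₁ p₁ Θ : ℝ} (hΘ₀ : 0 ≤ Θ) (hΘ₁ : Θ ≤ 1) (hp : 0 < p)
    (hp₀ : 0 < p₀) (hp₁ : 0 < p₁) (h₀ : p₀ / u₀ = p / u) (h₁ : p₁ / u₁ = p / u)
    (hpp : 1 / p = (1 - Θ) / p₀ + Θ / p₁) {φ ψ : EuclideanSpace ℝ (Fin n) → ℝ≥0∞}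
    (hφ : AEMeasurable φ (volume.restrict (unitCube n)))
    (hψ : AEMeasurable ψ (volume.restrict (unitCube n))) :
    morreyLENorm u p (fun y => φ y ^ (1 - Θ) * ψ y ^ Θ) ≤
      morreyLENorm u₀ p₀ φ ^ (1 - Θ) * morreyLENorm u₁ p₁ ψ ^ Θ := by
  refine (morreyLENorm_le_iff hp).2 fun x hx r hr => ?_
  have h1 : 0 ≤ 1 - Θ := by linarith
  set a : ℝ := (1 - Θ) * p / p₀ with ha
  set b : ℝ := Θ * p / p₁ with hb
  have ha0 : 0 ≤ a := by positivity
  have hb0 : 0 ≤ b := by positivity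
  have hab : a + b = 1 := by
    have : a + b = p * ((1 - Θ) / p₀ + Θ / p₁) := by rw [ha, hb]; ring
    rw [this, ← hpp]; field_simp
  have hpa : p₀ * a = (1 - Θ) * p := by rw [ha]; field_simp
  have hpb : p₁ * b = Θ * p := by rw [hb]; field_simp
  set V := volume (Metric.ball x r ∩ unitCube n)
  have hV0 : V ≠ 0 := volume_ball_inter_unitCube_ne_zero hx hr
  have hVt : V ≠ ∞ := volume_ball_inter_unitCube_ne_top x r
  have hH := ENNReal.lintegral_mul_norm_pow_le
    ((aemeasurable_inter_ball hφ x r).pow_const p₀)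
    ((aemeasurable_inter_ball hψ x r).pow_const p₁) ha0 hb0 hab
  simp_rw [← ENNReal.rpow_mul, hpa, hpb] at hH
  simp_rw [ENNReal.mul_rpow_of_nonneg _ _ hp.le, ← ENNReal.rpow_mul]
  have e₀ := ENNReal.rpow_le_rpow (morreyLENorm_spec (u := u₀) hp₀ φ hx hr) ha0
  have e₁ := ENNReal.rpow_le_rpow (morreyLENorm_spec (u := u₁) hp₁ ψ hx hr) hb0
  rw [ENNReal.mul_rpow_of_nonneg _ _ ha0, ← ENNReal.rpow_mul, ← ENNReal.rpow_mul, hpa, h₀] at e₀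
  rw [ENNReal.mul_rpow_of_nonneg _ _ hb0, ← ENNReal.rpow_mul, ← ENNReal.rpow_mul, hpb, h₁] at e₁
  refine le_trans (mul_le_mul_right hH _) (le_trans (le_of_eq ?_) (mul_le_mul' e₀ e₁))
  have hV : V ^ (p / u - 1) = V ^ ((p / u - 1) * a) * V ^ ((p / u - 1) * b) := by
    rw [← ENNReal.rpow_add _ _ hV0 hVt, ← mul_add, hab, mul_one]
  rw [hV, mul_mul_mul_comm]

/-- A single term is controlled by the average over all partial sums. -/
lemma card_powerset_mul_enorm_rpow_le {ι : Type*} {p : ℝ} (hp : 1 ≤ p) (F : Finset ι) (b : ι → ℂ)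
    {k : ι} (hk : k ∈ F) :
    (F.powerset.card : ℝ≥0∞) * ‖b k‖ₑ ^ p ≤ 2 ^ p * ∑ S ∈ F.powerset, ‖∑ i ∈ S, b i‖ₑ ^ p := by
  classical
  rw [← nsmul_eq_mul, ← Finset.sum_const, ← Finset.insert_erase hk,
    Finset.sum_powerset_insert (Finset.notMem_erase k F),
    Finset.sum_powerset_insert (Finset.notMem_erase k F), ← Finset.sum_add_distrib,
    ← Finset.sum_add_distrib, Finset.mul_sum]
  refine Finset.sum_le_sum fun S hS => ?_
  have hkS : k ∉ S := fun h => Finset.notMem_erase k F (Finset.mem_powerset.1 hS h)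
  rw [Finset.sum_insert hkS]
  set X := ∑ i ∈ S, b i
  have h1 : ‖b k‖ₑ ≤ ‖b k + X‖ₑ + ‖X‖ₑ := by
    simpa using enorm_sub_le (a := b k + X) (b := X)
  have h2 : ‖b k‖ₑ ^ p ≤ 2 ^ (p - 1) * (‖b k + X‖ₑ ^ p + ‖X‖ₑ ^ p) :=
    (ENNReal.rpow_le_rpow h1 (by linarith)).trans (ENNReal.rpow_add_le_mul_rpow_add_rpow _ _ hp)
  calc ‖b k‖ₑ ^ p + ‖b k‖ₑ ^ p = 2 ^ (1 : ℝ) * ‖b k‖ₑ ^ p := by rw [ENNReal.rpow_one, two_mul]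
    _ ≤ 2 ^ (1 : ℝ) * (2 ^ (p - 1) * (‖b k + X‖ₑ ^ p + ‖X‖ₑ ^ p)) := by gcongr
    _ = 2 ^ p * (‖X‖ₑ ^ p + ‖b k + X‖ₑ ^ p) := by
      rw [← mul_assoc, ← ENNReal.rpow_add _ _ (by norm_num) (by norm_num), add_sub_cancel,
        add_comm (‖X‖ₑ ^ p)]

/-- The maximal function of a finite family is bounded by twice the largest partial sum. -/
lemma morreyLENorm_finset_sup_le {ι : Type*} {u p : ℝ} (hp : 1 ≤ p) (F : Finset ι)
    {b : ι → EuclideanSpace ℝ (Fin n) → ℂ}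
    (hb : ∀ i, AEStronglyMeasurable (b i) (volume.restrict (unitCube n))) {D : ℝ≥0∞}
    (h : ∀ S ⊆ F, morreyLENorm u p (fun y => ‖∑ i ∈ S, b i y‖ₑ) ≤ D) :
    morreyLENorm u p (fun y => F.sup fun i => ‖b i y‖ₑ) ≤ 2 * D := by
  have hp0 : 0 < p := by linarith
  refine (morreyLENorm_le_iff hp0).2 fun x hx r hr => ?_
  have hN0 : (F.powerset.card : ℝ≥0∞) ≠ 0 := by
    simp
  have hNt : (F.powerset.card : ℝ≥0∞) ≠ ∞ := ENNReal.natCast_ne_top _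
  -- Multiplying by the number of subsets replaces the average over subsets by a sum, which commutes
  -- with the integral over each ball.
  rw [← ENNReal.mul_le_mul_iff_right hN0 hNt, mul_left_comm, ← lintegral_const_mul' _ _ hNt]
  have hpt : ∀ y, (F.powerset.card : ℝ≥0∞) * (F.sup fun i => ‖b i y‖ₑ) ^ p ≤
      2 ^ p * ∑ S ∈ F.powerset, ‖∑ i ∈ S, b i y‖ₑ ^ p := by
    intro y
    rcases F.eq_empty_or_nonempty with rfl | hF
    · simp [ENNReal.zero_rpow_of_pos hp0]
    · obtain ⟨k, hk, hk'⟩ := Finset.exists_mem_eq_sup F hF fun i => ‖b i y‖ₑ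
      rw [hk']
      exact card_powerset_mul_enorm_rpow_le hp F (fun i => b i y) hk
  have h2t : (2 : ℝ≥0∞) ^ p ≠ ∞ := ENNReal.rpow_ne_top_of_nonneg hp0.le (by norm_num)
  refine (mul_le_mul_right (lintegral_mono hpt) _).trans ?_
  rw [lintegral_const_mul' _ _ h2t, lintegral_finsetSum']
  · rw [mul_left_comm, Finset.mul_sum, ENNReal.mul_rpow_of_nonneg _ _ hp0.le, mul_left_comm]
    gcongr
    rw [← nsmul_eq_mul]
    refine Finset.sum_le_card_nsmul _ _ _ fun S hS => ?_
    exact (morreyLENorm_le_iff hp0).1 (h S (Finset.mem_powerset.1 hS)) x hx r hr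
  · intro S _
    exact ((aemeasurable_inter_ball (Finset.aestronglyMeasurable_fun_sum S
      fun i _ => hb i).enorm x r)).pow_const p

lemma lintegral_unitCube_rpow_le {u p : ℝ} (hp : 0 < p) (φ : EuclideanSpace ℝ (Fin n) → ℝ≥0∞) :
    ∫⁻ y in unitCube n, φ y ^ p ≤ morreyLENorm u p φ ^ p := by
  obtain ⟨r, hr, h⟩ := exists_ball_superset_unitCube (n := n)
  have := morreyLENorm_spec (u := u) hp φ half_mem_unitCube hr
  rwa [h, volume_unitCube, ENNReal.one_rpow, one_mul] at this

/-- Morrey functionals of the same density `p / u` increase with `p`. -/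
lemma morreyLENorm_le_of_le {u p v q : ℝ} (hq : 0 < q) (hqp : q ≤ p) (hκ : q / v = p / u)
    (hpu : 0 ≤ p / u)
    {φ : EuclideanSpace ℝ (Fin n) → ℝ≥0∞} (hφ : AEMeasurable φ (volume.restrict (unitCube n))) :
    morreyLENorm v q φ ≤ morreyLENorm u p φ := by
  have hp : 0 < p := hq.trans_le hqp
  refine (morreyLENorm_le_iff hq).2 fun x hx r hr => ?_
  have h := ENNReal.rpow_le_rpow (morreyLENorm_spec (u := u) hp φ hx hr)
    (show 0 ≤ q / p by positivity)
  rw [ENNReal.mul_rpow_of_nonneg _ _ (by positivity), ← ENNReal.rpow_mul, ← ENNReal.rpow_mul,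
    mul_div_cancel₀ q hp.ne'] at h
  refine le_trans ?_ h
  set V := volume (Metric.ball x r ∩ unitCube n) with hV
  have hV0 : V ≠ 0 := volume_ball_inter_unitCube_ne_zero hx hr
  have hVt : V ≠ ∞ := volume_ball_inter_unitCube_ne_top x r
  have hH := ENNReal.lintegral_mul_norm_pow_le
    ((aemeasurable_inter_ball hφ x r).pow_const p)
    (aemeasurable_const (b := (1 : ℝ≥0∞))) (show 0 ≤ q / p by positivity)
    (show 0 ≤ 1 - q / p by rw [sub_nonneg, div_le_one hp]; exact hqp) (by ring)
  simp_rw [← ENNReal.rpow_mul, mul_div_cancel₀ q hp.ne', ENNReal.one_rpow, mul_one] at hH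
  rw [lintegral_one, Measure.restrict_apply_univ, ← hV] at hH
  refine (mul_le_mul_right hH _).trans ?_
  rw [mul_left_comm, mul_comm, ← ENNReal.rpow_add _ _ hV0 hVt, hκ]
  gcongr 1
  -- Volumes are at most 1, so the larger exponent gives the smaller power; the exponents differ by
  -- `(p / u) * (1 - q / p)`.
  refine ENNReal.rpow_le_rpow_of_exponent_ge (volume_ball_inter_unitCube_le x r) ?_
  have : 0 ≤ (p / u) * (1 - q / p) :=
    mul_nonneg hpu (by rw [sub_nonneg, div_le_one hp]; exact hqp)
  linarith

lemma lintegral_unitCube_le {u p : ℝ} (hp : 1 ≤ p) {φ : EuclideanSpace ℝ (Fin n) → ℝ≥0∞}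
    (hφ : AEMeasurable φ (volume.restrict (unitCube n))) :
    ∫⁻ y in unitCube n, φ y ≤ morreyLENorm u p φ := by
  have hp0 : 0 < p := by linarith
  have h := ENNReal.lintegral_mul_norm_pow_le (hφ.pow_const p)
    (aemeasurable_const (b := (1 : ℝ≥0∞))) (show 0 ≤ 1 / p by positivity)
    (show 0 ≤ 1 - 1 / p by rw [sub_nonneg, div_le_one hp0]; exact hp) (by ring)
  simp_rw [← ENNReal.rpow_mul, mul_one_div_cancel hp0.ne', ENNReal.one_rpow, mul_one,
    ENNReal.rpow_one] at h
  refine h.trans ?_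
  simp only [lintegral_one, Measure.restrict_apply_univ, volume_unitCube, ENNReal.one_rpow,
    mul_one]
  rw [one_div, ENNReal.rpow_inv_le_iff hp0]
  exact lintegral_unitCube_rpow_le hp0 φ

/-- A bounded function with small integral has small Morrey norm. -/
lemma morreyLENorm_le_of_bounded {u p : ℝ} (hp : 0 < p) (hu : 0 < u) (hpu : p ≤ u) {A η : ℝ≥0∞}
    {φ : EuclideanSpace ℝ (Fin n) → ℝ≥0∞}
    (hA : ∀ᵐ y ∂volume.restrict (unitCube n), φ y ≤ A)
    (hη : ∫⁻ y in unitCube n, φ y ^ p ≤ η) :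
    morreyLENorm u p φ ≤ A ^ (1 - p / u) * η ^ (1 / u) := by
  refine (morreyLENorm_le_iff hp).2 fun x hx r hr => ?_
  have hκ0 : 0 < p / u := by positivity
  have hκ1 : 0 ≤ 1 - p / u := by rw [sub_nonneg, div_le_one hu]; exact hpu
  set V := volume (Metric.ball x r ∩ unitCube n) with hV
  have hV0 : V ≠ 0 := volume_ball_inter_unitCube_ne_zero hx hr
  have hVt : V ≠ ∞ := volume_ball_inter_unitCube_ne_top x r
  set I := ∫⁻ y in Metric.ball x r ∩ unitCube n, φ y ^ p with hI
  have h1 : I ≤ A ^ p * V := by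
    rw [hV, ← setLIntegral_const]
    refine lintegral_mono_ae ?_
    filter_upwards [ae_restrict_of_ae_restrict_of_subset Set.inter_subset_right hA] with y hy
    gcongr
  have h2 : I ≤ η := (lintegral_mono_set Set.inter_subset_right).trans hη
  -- One factor is bounded by the supremum and absorbs the singular volume power, the other by the
  -- total integral.
  have h3 : I = I ^ (1 - p / u) * I ^ (p / u) := by
    rw [← ENNReal.rpow_add_of_nonneg _ _ hκ1 hκ0.le]; simp
  calc V ^ (p / u - 1) * I ≤ V ^ (p / u - 1) * ((A ^ p * V) ^ (1 - p / u) * η ^ (p / u)) := by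
        rw [h3]; gcongr
    _ = (V ^ (p / u - 1) * V ^ (1 - p / u)) * ((A ^ p) ^ (1 - p / u) * η ^ (p / u)) := by
        rw [ENNReal.mul_rpow_of_nonneg _ _ hκ1]; ring
    _ = (A ^ (1 - p / u) * η ^ (1 / u)) ^ p := by
        rw [← ENNReal.rpow_add _ _ hV0 hVt, ENNReal.mul_rpow_of_nonneg _ _ hp.le,
          ← ENNReal.rpow_mul, ← ENNReal.rpow_mul, ← ENNReal.rpow_mul, mul_comm p,
          one_div_mul_eq_div]
        simp

lemma morreyLENorm_le_const {u p : ℝ} (hp : 0 < p) (hu : 0 < u) {A : ℝ≥0∞}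
    {φ : EuclideanSpace ℝ (Fin n) → ℝ≥0∞}
    (hA : ∀ᵐ y ∂volume.restrict (unitCube n), φ y ≤ A) :
    morreyLENorm u p φ ≤ A := by
  refine (morreyLENorm_le_iff hp).2 fun x hx r hr => ?_
  set V := volume (Metric.ball x r ∩ unitCube n) with hV
  have hV0 : V ≠ 0 := volume_ball_inter_unitCube_ne_zero hx hr
  have hVt : V ≠ ∞ := volume_ball_inter_unitCube_ne_top x r
  have h1 : ∫⁻ y in Metric.ball x r ∩ unitCube n, φ y ^ p ≤ A ^ p * V := by
    rw [hV, ← setLIntegral_const]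
    refine lintegral_mono_ae ?_
    filter_upwards [ae_restrict_of_ae_restrict_of_subset Set.inter_subset_right hA] with y hy
    gcongr
  calc _ ≤ V ^ (p / u - 1) * (A ^ p * V) := by gcongr
    _ = A ^ p * V ^ (p / u) := by
      rw [mul_left_comm]; congr 1
      conv_lhs => rw [← ENNReal.rpow_one V, ← ENNReal.rpow_mul, one_mul]
      rw [← ENNReal.rpow_add _ _ hV0 hVt, sub_add_cancel]
    _ ≤ A ^ p * 1 := by
      gcongr
      exact ENNReal.rpow_le_one (volume_ball_inter_unitCube_le x r) (by positivity)
    _ = A ^ p := mul_one _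

/-- The Morrey norm is lower semicontinuous with respect to convergence in `L¹`. -/
lemma morreyLENorm_le_of_tendsto {u p : ℝ} (hp : 0 < p)
    {f : ℕ → EuclideanSpace ℝ (Fin n) → ℂ} {g : EuclideanSpace ℝ (Fin n) → ℂ}
    (hf : ∀ k, AEStronglyMeasurable (f k) (volume.restrict (unitCube n)))
    (hg : AEStronglyMeasurable g (volume.restrict (unitCube n)))
    (hfg : Tendsto (fun k => ∫⁻ y in unitCube n, ‖f k y - g y‖ₑ) atTop (𝓝 0)) {D : ℝ≥0∞}
    (hD : ∀ k, morreyLENorm u p (fun y => ‖f k y‖ₑ) ≤ D) :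
    morreyLENorm u p (fun y => ‖g y‖ₑ) ≤ D := by
  -- A subsequence converges almost everywhere, and Fatou's lemma applies on each ball.
  have hm : TendstoInMeasure (volume.restrict (unitCube n)) f atTop g := by
    refine tendstoInMeasure_of_tendsto_eLpNorm (p := 1) one_ne_zero hf hg ?_
    simpa [eLpNorm_one_eq_lintegral_enorm] using hfg
  obtain ⟨ns, -, hns⟩ := hm.exists_seq_tendsto_ae
  refine (morreyLENorm_le_iff hp).2 fun x hx r hr => ?_
  set V := volume (Metric.ball x r ∩ unitCube n) with hV
  have hV0 : V ≠ 0 := volume_ball_inter_unitCube_ne_zero hx hr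
  have hVt : V ≠ ∞ := volume_ball_inter_unitCube_ne_top x r
  have hVκ : V ^ (p / u - 1) ≠ ∞ := by simp [hV0, hVt]
  rw [← lintegral_const_mul' _ _ hVκ]
  have h1 : ∀ᵐ y ∂volume.restrict (Metric.ball x r ∩ unitCube n),
      V ^ (p / u - 1) * ‖g y‖ₑ ^ p =
        liminf (fun k => V ^ (p / u - 1) * ‖f (ns k) y‖ₑ ^ p) atTop := by
    filter_upwards [ae_restrict_of_ae_restrict_of_subset Set.inter_subset_right hns] with y hy
    refine (Tendsto.liminf_eq ?_).symm
    refine ENNReal.Tendsto.const_mul ?_ (Or.inr hVκ)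
    exact (ENNReal.continuous_rpow_const.tendsto _).comp hy.enorm
  rw [lintegral_congr_ae h1]
  refine (lintegral_liminf_le' fun k => ?_).trans ?_
  · exact ((aemeasurable_inter_ball (hf _).enorm x r).pow_const p).const_mul _
  · refine liminf_le_of_frequently_le' (Frequently.of_forall fun k => ?_)
    rw [lintegral_const_mul' _ _ hVκ]
    exact (morreyLENorm_le_iff hp).1 (hD (ns k)) x hx r hr

end MorreyFunctional

/-! ### Smooth functions with integrable derivatives on the cube are bounded -/

section Sobolev

variable {n : ℕ}

/-- The fundamental theorem of calculus gives `|h x| ≤ |h y| + ∫ |h'|`; average over `y` in the unit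
interval. -/
lemma enorm_le_lintegral_add_deriv {h h' : ℝ → ℂ}
    (hd : ∀ t ∈ Set.Ioo (0 : ℝ) 1, HasDerivAt h (h' t) t)
    (hc : ContinuousOn h' (Set.Ioo 0 1)) {x : ℝ} (hx : x ∈ Set.Ioo (0 : ℝ) 1) :
    ‖h x‖ₑ ≤ ∫⁻ t in Set.Ioo (0 : ℝ) 1, (‖h t‖ₑ + ‖h' t‖ₑ) := by
  have key : ∀ y ∈ Set.Ioo (0 : ℝ) 1,
      ‖h x‖ₑ ≤ ‖h y‖ₑ + ∫⁻ t in Set.Ioo (0 : ℝ) 1, ‖h' t‖ₑ := by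
    intro y hy
    have hsub : Set.uIcc y x ⊆ Set.Ioo 0 1 := Set.ordConnected_Ioo.uIcc_subset hy hx
    have hint : ∫ t in y..x, h' t = h x - h y :=
      intervalIntegral.integral_eq_sub_of_hasDerivAt (fun t ht => hd t (hsub ht))
        ((hc.mono hsub).intervalIntegrable)
    have h1 : ‖h x - h y‖ₑ ≤ ∫⁻ t in Set.Ioo (0 : ℝ) 1, ‖h' t‖ₑ := by
      rw [← hint, ← ofReal_norm, intervalIntegral.norm_integral_eq_norm_integral_uIoc,
        ofReal_norm]
      exact (enorm_integral_le_lintegral_enorm _).trans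
        (lintegral_mono_set (Set.uIoc_subset_uIcc.trans hsub))
    calc ‖h x‖ₑ = ‖h y + (h x - h y)‖ₑ := by rw [add_sub_cancel]
      _ ≤ _ := (enorm_add_le _ _).trans (by gcongr)
  have hm : AEMeasurable (fun t => ‖h t‖ₑ) (volume.restrict (Set.Ioo (0 : ℝ) 1)) :=
    (ContinuousOn.aestronglyMeasurable
      (fun t ht => (hd t ht).continuousAt.continuousWithinAt) measurableSet_Ioo).enorm
  rw [lintegral_add_left' hm]
  calc ‖h x‖ₑ = ∫⁻ _ in Set.Ioo (0 : ℝ) 1, ‖h x‖ₑ := by simp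
    _ ≤ ∫⁻ y in Set.Ioo (0 : ℝ) 1, (‖h y‖ₑ + ∫⁻ t in Set.Ioo (0 : ℝ) 1, ‖h' t‖ₑ) :=
      setLIntegral_mono' measurableSet_Ioo key
    _ = _ := by rw [lintegral_add_right _ measurable_const]; simp

variable {g : EuclideanSpace ℝ (Fin n) → ℂ}

lemma hasFDerivAt_iteratedFDeriv (hg : ContDiffOn ℝ ((⊤ : ℕ∞) : WithTop ℕ∞) g (unitCube n))
    (k : ℕ) {x : EuclideanSpace ℝ (Fin n)} (hx : x ∈ unitCube n) :
    HasFDerivAt (iteratedFDeriv ℝ k g) (fderiv ℝ (iteratedFDeriv ℝ k g) x) x := by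
  have h1 : ContDiffAt ℝ ((⊤ : ℕ∞) : WithTop ℕ∞) g x := hg.contDiffAt (isOpen_unitCube.mem_nhds hx)
  exact (h1.differentiableAt_iteratedFDeriv (by exact_mod_cast ENat.natCast_lt_top k)).hasFDerivAt

lemma continuousOn_iteratedPartial (hg : ContDiffOn ℝ ((⊤ : ℕ∞) : WithTop ℕ∞) g (unitCube n))
    {k : ℕ} (w : Fin k → Fin n) : ContinuousOn (iteratedPartial w g) (unitCube n) := by
  intro x hx
  refine ContinuousAt.continuousWithinAt ?_
  exact (hasFDerivAt_iteratedFDeriv hg k hx).continuousAt.eval_const _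

lemma hasDerivAt_iteratedPartial (hg : ContDiffOn ℝ ((⊤ : ℕ∞) : WithTop ℕ∞) g (unitCube n))
    {k : ℕ} (w : Fin k → Fin n) (i : Fin n) (y : Fin n → ℝ) {t : ℝ}
    (ht : WithLp.toLp 2 (Function.update y i t) ∈ unitCube n) :
    HasDerivAt (fun t => iteratedPartial w g (WithLp.toLp 2 (Function.update y i t)))
      (iteratedPartial (Fin.cons i w) g (WithLp.toLp 2 (Function.update y i t))) t := by
  have h1 := hasFDerivAt_iteratedFDeriv hg k ht
  have h2 : HasDerivAt (fun t : ℝ => (WithLp.toLp 2 (Function.update y i t) :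
      EuclideanSpace ℝ (Fin n))) (EuclideanSpace.single i 1) t := by
    have := (PiLp.continuousLinearEquiv 2 ℝ (fun _ : Fin n => ℝ)).symm.hasFDerivAt.comp_hasDerivAt t
      (hasDerivAt_update y i t)
    exact this
  have h3 := h1.comp_hasDerivAt t h2
  have h4 := (ContinuousMultilinearMap.apply ℝ (fun _ : Fin k => EuclideanSpace ℝ (Fin n)) ℂ
    (fun l => EuclideanSpace.single (w l) (1 : ℝ))).hasFDerivAt.comp_hasDerivAt t h3
  have h5 : iteratedPartial (Fin.cons i w) g (WithLp.toLp 2 (Function.update y i t)) =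
      ContinuousMultilinearMap.apply ℝ (fun _ : Fin k => EuclideanSpace ℝ (Fin n)) ℂ
        (fun l => EuclideanSpace.single (w l) (1 : ℝ))
        (fderiv ℝ (iteratedFDeriv ℝ k g) (WithLp.toLp 2 (Function.update y i t))
          (EuclideanSpace.single i 1)) := by
    simp [iteratedPartial, iteratedFDeriv_succ_apply_left, Fin.tail_def]
  rw [h5]
  exact h4

/-- The modulus of a partial derivative, extended by zero to all of `Fin n → ℝ`. -/
def partialIndicator (g : EuclideanSpace ℝ (Fin n) → ℂ) {k : ℕ} (w : Fin k → Fin n) :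
    (Fin n → ℝ) → ℝ≥0∞ :=
  (Set.univ.pi fun _ => Set.Ioo (0 : ℝ) 1).indicator
    fun y => ‖iteratedPartial w g (WithLp.toLp 2 y)‖ₑ

lemma toLp_mem_unitCube {y : Fin n → ℝ} :
    WithLp.toLp 2 y ∈ unitCube n ↔ y ∈ Set.univ.pi fun _ : Fin n => Set.Ioo (0 : ℝ) 1 := by
  simp [unitCube, Set.mem_pi]

lemma measurable_partialIndicator (hg : ContDiffOn ℝ ((⊤ : ℕ∞) : WithTop ℕ∞) g (unitCube n))
    {k : ℕ} (w : Fin k → Fin n) : Measurable (partialIndicator g w) := by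
  have hm : MeasurableSet (Set.univ.pi fun _ : Fin n => Set.Ioo (0 : ℝ) 1) :=
    MeasurableSet.univ_pi fun _ => measurableSet_Ioo
  have hc : ContinuousOn (fun y => ‖iteratedPartial w g (WithLp.toLp 2 y)‖ₑ)
      (Set.univ.pi fun _ : Fin n => Set.Ioo (0 : ℝ) 1) :=
    ((continuousOn_iteratedPartial hg w).comp (PiLp.continuous_toLp 2 _).continuousOn
      fun y hy => toLp_mem_unitCube.2 hy).enorm
  classical
  exact hc.measurable_piecewise (continuousOn_const (c := 0)) hm

lemma lintegral_partialIndicator {k : ℕ} (w : Fin k → Fin n) :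
    ∫⁻ y, partialIndicator g w y = ∫⁻ x in unitCube n, ‖iteratedPartial w g x‖ₑ := by
  rw [partialIndicator, lintegral_indicator (MeasurableSet.univ_pi fun _ => measurableSet_Ioo),
    unitCube_eq_preimage,
    ← (PiLp.volume_preserving_ofLp (Fin n)).setLIntegral_comp_preimage_emb
      (MeasurableEquiv.toLp 2 (Fin n → ℝ)).symm.measurableEmbedding]

lemma partialIndicator_le (hg : ContDiffOn ℝ ((⊤ : ℕ∞) : WithTop ℕ∞) g (unitCube n))
    {k : ℕ} (w : Fin k → Fin n) (i : Fin n) (y : Fin n → ℝ) :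
    partialIndicator g w y ≤ ∫⁻ t, (partialIndicator g w (Function.update y i t) +
      partialIndicator g (Fin.cons i w : Fin (k + 1) → Fin n) (Function.update y i t)) := by
  by_cases hy : y ∈ Set.univ.pi fun _ : Fin n => Set.Ioo (0 : ℝ) 1
  swap
  · simp [partialIndicator, hy]
  have hmem : ∀ t ∈ Set.Ioo (0 : ℝ) 1,
      Function.update y i t ∈ Set.univ.pi fun _ : Fin n => Set.Ioo (0 : ℝ) 1 := by
    intro t ht j _
    by_cases hj : j = i
    · subst hj; simpa using ht
    · simpa [hj] using hy j trivial
  have h1 := enorm_le_lintegral_add_deriv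
    (fun t ht => hasDerivAt_iteratedPartial hg w i y (toLp_mem_unitCube.2 (hmem t ht)))
    ((continuousOn_iteratedPartial hg (Fin.cons i w : Fin (k + 1) → Fin n)).comp
      (f := fun t => WithLp.toLp 2 (Function.update y i t))
      ((PiLp.continuous_toLp 2 (fun _ : Fin n => ℝ)).comp
        ((continuous_const (y := y)).update i continuous_id)).continuousOn
      fun t ht => toLp_mem_unitCube.2 (hmem t ht)) (hy i trivial)
  rw [Function.update_eq_self] at h1
  refine (Eq.trans_le ?_ h1).trans ((setLIntegral_congr_fun measurableSet_Ioo fun t ht => ?_).trans_le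
    (setLIntegral_le_lintegral _ _))
  · simp only [partialIndicator, Set.indicator_of_mem hy]
  · simp only [partialIndicator, Set.indicator_of_mem (hmem t ht)]

/-- Iterating the one-dimensional inequality over the coordinates in `s` costs one derivative per
coordinate. All `w` are treated at once because the step for `i` also uses the hypothesis for
`Fin.cons i w`. For `s` the full set the marginal is a constant, which is a sup bound. -/
lemma exists_partialIndicator_le_lmarginal
    (hg : ContDiffOn ℝ ((⊤ : ℕ∞) : WithTop ℕ∞) g (unitCube n))
    (hint : ∀ (k : ℕ) (w : Fin k → Fin n), ∫⁻ x in unitCube n, ‖iteratedPartial w g x‖ₑ < ∞)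
    (s : Finset (Fin n)) : ∀ (k : ℕ) (w : Fin k → Fin n), ∃ h : (Fin n → ℝ) → ℝ≥0∞,
      Measurable h ∧ ∫⁻ y, h y < ∞ ∧ partialIndicator g w ≤ ∫⋯∫⁻_s, h ∂fun _ => volume := by
  induction s using Finset.induction with
  | empty =>
    intro k w
    exact ⟨partialIndicator g w, measurable_partialIndicator hg w,
      by rw [lintegral_partialIndicator]; exact hint k w, by simp⟩
  | insert i s hi ih =>
    intro k w
    obtain ⟨h₁, hm₁, hi₁, hle₁⟩ := ih k w
    obtain ⟨h₂, hm₂, hi₂, hle₂⟩ := ih (k + 1) (Fin.cons i w)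
    refine ⟨h₁ + h₂, hm₁.add hm₂, ?_, fun y => ?_⟩
    · simp only [Pi.add_apply]
      rw [lintegral_add_left hm₁]
      exact ENNReal.add_lt_top.2 ⟨hi₁, hi₂⟩
    · rw [lmarginal_insert _ (hm₁.add hm₂) hi]
      refine (partialIndicator_le hg w i y).trans (lintegral_mono fun t => ?_)
      refine (add_le_add (hle₁ _) (hle₂ _)).trans_eq ?_
      simp only [lmarginal, Pi.add_apply]
      rw [lintegral_add_left]
      exact hm₁.comp (measurable_updateFinset)

lemma exists_bound_of_smooth (hg : ContDiffOn ℝ ((⊤ : ℕ∞) : WithTop ℕ∞) g (unitCube n))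
    (hint : ∀ (k : ℕ) (w : Fin k → Fin n), ∫⁻ x in unitCube n, ‖iteratedPartial w g x‖ₑ < ∞) :
    ∃ t : ℝ≥0, ∀ x ∈ unitCube n, ‖g x‖ₑ ≤ t := by
  obtain ⟨h, -, hi, hle⟩ := exists_partialIndicator_le_lmarginal hg hint Finset.univ 0 Fin.elim0
  refine ⟨(∫⁻ y, h y).toNNReal, fun x hx => ?_⟩
  rw [ENNReal.coe_toNNReal hi.ne]
  have h1 := hle x.ofLp
  rw [lmarginal_univ] at h1
  refine le_trans ?_ h1
  rw [partialIndicator, Set.indicator_of_mem (toLp_mem_unitCube.1 hx)]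
  simp [iteratedPartial]

end Sobolev

/-! ### The diamond closure is the closure of the bounded functions -/

section DiamondClosure

variable {n : ℕ}

lemma morreyENorm_eq (u p : ℝ) (f : EuclideanSpace ℝ (Fin n) →ₘ[volume.restrict (unitCube n)] ℂ) :
    morreyENorm (unitCube n) u p f = morreyLENorm u p fun y => ‖f y‖ₑ := rfl

lemma morreyENorm_add_le {u p : ℝ} (hp : 1 ≤ p)
    (f g : EuclideanSpace ℝ (Fin n) →ₘ[volume.restrict (unitCube n)] ℂ) :
    morreyENorm (unitCube n) u p (f + g) ≤
      morreyENorm (unitCube n) u p f + morreyENorm (unitCube n) u p g := by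
  refine le_trans (morreyLENorm_mono_ae (by linarith) ?_)
    (morreyLENorm_add_le hp f.aestronglyMeasurable.enorm g.aestronglyMeasurable.enorm)
  filter_upwards [AEEqFun.coeFn_add f g] with y hy
  rw [hy]
  exact enorm_add_le _ _

lemma morreyENorm_congr {u p : ℝ} (hp : 0 < p)
    {f : EuclideanSpace ℝ (Fin n) →ₘ[volume.restrict (unitCube n)] ℂ}
    {g : EuclideanSpace ℝ (Fin n) → ℂ} (h : f =ᵐ[volume.restrict (unitCube n)] g) :
    morreyENorm (unitCube n) u p f = morreyLENorm u p fun y => ‖g y‖ₑ :=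
  morreyLENorm_congr_ae hp (h.mono fun y hy => by simp only [hy])

lemma morreyENorm_neg {u p : ℝ} (hp : 0 < p)
    (f : EuclideanSpace ℝ (Fin n) →ₘ[volume.restrict (unitCube n)] ℂ) :
    morreyENorm (unitCube n) u p (-f) = morreyENorm (unitCube n) u p f := by
  rw [morreyENorm_congr hp (AEEqFun.coeFn_neg f)]
  simp [morreyENorm_eq]

lemma morreyENorm_zero {u p : ℝ} (hp : 0 < p) :
    morreyENorm (unitCube n) u p 0 = 0 := by
  rw [morreyENorm_congr hp AEEqFun.coeFn_zero]
  refine le_antisymm ((morreyLENorm_le_iff hp).2 fun x hx r hr => ?_) bot_le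
  simp [ENNReal.zero_rpow_of_pos hp]

lemma morreyENorm_sub_le {u p : ℝ} (hp : 1 ≤ p)
    (f g : EuclideanSpace ℝ (Fin n) →ₘ[volume.restrict (unitCube n)] ℂ) :
    morreyENorm (unitCube n) u p (f - g) ≤
      morreyENorm (unitCube n) u p f + morreyENorm (unitCube n) u p g := by
  rw [sub_eq_add_neg, ← morreyENorm_neg (by linarith) g]
  exact morreyENorm_add_le hp _ _

lemma enorm_le_coe_iff_norm_le {z : ℂ} {t : ℝ≥0} : ‖z‖ₑ ≤ t ↔ ‖z‖ ≤ t := by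
  rw [enorm_le_coe, ← NNReal.coe_le_coe, coe_nnnorm]

lemma tendsto_rpow_zero {ι : Type*} {l : Filter ι} {f : ι → ℝ≥0∞} (hf : Tendsto f l (𝓝 0))
    {a : ℝ} (ha : 0 < a) : Tendsto (fun i => f i ^ a) l (𝓝 0) := by
  have := (ENNReal.continuous_rpow_const (y := a)).tendsto 0
  rw [ENNReal.zero_rpow_of_pos ha] at this
  exact this.comp hf

lemma closureIn_subset_closureIn {Y : Type*} [AddCommGroup Y] {N : Y → ℝ≥0∞}
    (hN : ∀ f g, N (f + g) ≤ N f + N g) {S T : Set Y} (h : S ⊆ closureIn N T) :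
    closureIn N S ⊆ closureIn N T := by
  rintro f ⟨hf, hf'⟩
  refine ⟨hf, fun δ hδ => ?_⟩
  obtain ⟨g, hg, hfg⟩ := hf' (δ / 2) (ENNReal.half_pos hδ.ne')
  obtain ⟨k, hk, hgk⟩ := (h hg).2 (δ / 2) (ENNReal.half_pos hδ.ne')
  refine ⟨k, hk, ?_⟩
  calc N (f - k) = N ((f - g) + (g - k)) := by congr 1; abel
    _ ≤ _ := hN _ _
    _ < δ / 2 + δ / 2 := ENNReal.add_lt_add hfg hgk
    _ = δ := ENNReal.add_halves δ

/-- The essentially bounded functions on the unit cube. -/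
def boundedFun (n : ℕ) : Set (EuclideanSpace ℝ (Fin n) →ₘ[volume.restrict (unitCube n)] ℂ) :=
  {f | ∃ t : ℝ≥0, ∀ᵐ y ∂volume.restrict (unitCube n), ‖f y‖ₑ ≤ t}

lemma smoothMorrey_subset_boundedFun {u p : ℝ} (hp : 1 ≤ p) :
    smoothMorrey (unitCube n) u p ⊆ boundedFun n := by
  rintro f ⟨g, hg, hfg, hder⟩
  obtain ⟨t, ht⟩ := exists_bound_of_smooth hg fun k w => by
    refine (lintegral_unitCube_le hp ?_).trans_lt (hder k w)
    exact ((continuousOn_iteratedPartial hg w).aestronglyMeasurable measurableSet_unitCube).enorm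
  refine ⟨t, ?_⟩
  filter_upwards [hfg, ae_restrict_mem measurableSet_unitCube] with y hy hyQ
  rw [hy]
  exact ht y hyQ

lemma isBounded_unitCube : Bornology.IsBounded (unitCube n) := by
  obtain ⟨r, -, h⟩ := exists_ball_superset_unitCube (n := n)
  rw [← h]
  exact Metric.isBounded_ball.subset Set.inter_subset_left

/-- Smooth compactly supported functions belong to `smoothMorrey`. -/
lemma mem_smoothMorrey_of_hasCompactSupport {u p : ℝ} (hp : 0 < p) (hu : 0 < u)
    {g : EuclideanSpace ℝ (Fin n) → ℂ} (hg : ContDiff ℝ ((⊤ : ℕ∞) : WithTop ℕ∞) g)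
    (hc : HasCompactSupport g)
    {f : EuclideanSpace ℝ (Fin n) →ₘ[volume.restrict (unitCube n)] ℂ}
    (hfg : f =ᵐ[volume.restrict (unitCube n)] g) : f ∈ smoothMorrey (unitCube n) u p := by
  refine ⟨g, hg.contDiffOn, hfg, fun k w => ?_⟩
  obtain ⟨C, hC⟩ := (hg.continuous_iteratedFDeriv (m := k)
    (by exact_mod_cast le_top)).bounded_above_of_compact_support (hc.iteratedFDeriv k)
  refine (morreyLENorm_le_const (A := ENNReal.ofReal C) hp hu (ae_of_all _ fun y => ?_)).trans_lt
    ENNReal.ofReal_lt_top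
  rw [← ofReal_norm]
  refine ENNReal.ofReal_le_ofReal ?_
  refine ((iteratedFDeriv ℝ k g y).le_opNorm _).trans ?_
  simpa using hC y

/-- Approximation of a bounded function by uniformly bounded smooth functions. -/
lemma exists_smooth_approx {b : EuclideanSpace ℝ (Fin n) → ℂ} (hb : StronglyMeasurable b)
    {t : ℝ≥0} (ht : ∀ᵐ y ∂volume.restrict (unitCube n), ‖b y‖ₑ ≤ t) :
    ∃ g : ℕ → EuclideanSpace ℝ (Fin n) → ℂ,
      (∀ k, ContDiff ℝ ((⊤ : ℕ∞) : WithTop ℕ∞) (g k)) ∧ (∀ k, HasCompactSupport (g k)) ∧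
      (∀ k y, ‖g k y‖ ≤ t) ∧
      ∀ᵐ y ∂volume.restrict (unitCube n), Tendsto (fun k => g k y) atTop (𝓝 (b y)) := by
  -- Cutting `b` off where it exceeds `t` turns the almost everywhere bound into a bound everywhere,
  -- which convolution preserves.
  set s : Set (EuclideanSpace ℝ (Fin n)) := unitCube n ∩ {y | ‖b y‖ ≤ t} with hs
  have hms : MeasurableSet s :=
    measurableSet_unitCube.inter (measurableSet_le hb.norm.measurable measurable_const)
  set f := s.indicator b with hf
  have hfm : StronglyMeasurable f := hb.indicator hms
  have hft : ∀ y, ‖f y‖ ≤ t := by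
    intro y
    by_cases hy : y ∈ s
    · rw [hf, Set.indicator_of_mem hy]; exact hy.2
    · rw [hf, Set.indicator_of_notMem hy]; simp
  have hfs : HasCompactSupport f :=
    HasCompactSupport.of_support_subset_isCompact isBounded_unitCube.isCompact_closure
      (Set.support_indicator_subset.trans (Set.inter_subset_left.trans subset_closure))
  have hfi : Integrable f := by
    rw [hf, integrable_indicator_iff hms]
    refine Measure.integrableOn_of_bounded (M := t) ?_ hb.aestronglyMeasurable ?_
    · exact ((measure_mono Set.inter_subset_left).trans_lt
        (volume_unitCube (n := n) ▸ ENNReal.one_lt_top)).ne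
    · exact (ae_restrict_mem hms).mono fun y hy => hy.2
  -- The fixed ratio 2 of the radii is what the Lebesgue differentiation argument below requires.
  let φ : ℕ → ContDiffBump (0 : EuclideanSpace ℝ (Fin n)) := fun k =>
    ⟨1 / ((k : ℝ) + 1), 2 * (1 / ((k : ℝ) + 1)), by positivity, by
      have : 0 < 1 / ((k : ℝ) + 1) := by positivity
      linarith⟩
  refine ⟨fun k => convolution ((φ k).normed volume) f (ContinuousLinearMap.lsmul ℝ ℝ) volume,
    fun k => ?_, fun k => ?_, fun k y => ?_, ?_⟩
  · exact (φ k).hasCompactSupport_normed.contDiff_convolution_left _ (φ k).contDiff_normed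
      hfi.locallyIntegrable
  · exact HasCompactSupport.convolution _ (φ k).hasCompactSupport_normed hfs
  · rw [← dist_zero_right]
    exact dist_convolution_le t.2 (φ k).support_normed_eq.subset (φ k).nonneg_normed
      (φ k).integral_normed hfm.aestronglyMeasurable fun y _ => by
        rw [dist_zero_right]; exact hft y
  · have h0 : Tendsto (fun k => (φ k).rOut) atTop (𝓝 0) := by
      simpa [φ] using (tendsto_one_div_add_atTop_nhds_zero_nat (𝕜 := ℝ)).const_mul 2
    have h1 := ContDiffBump.ae_convolution_tendsto_right_of_locallyIntegrable (φ := φ) (K := 2) h0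
      (Eventually.of_forall fun k => le_rfl) hfi.locallyIntegrable
    filter_upwards [ae_restrict_of_ae h1, ht, ae_restrict_mem measurableSet_unitCube]
      with y hy hyt hyQ
    have hys : y ∈ s := ⟨hyQ, enorm_le_coe_iff_norm_le.1 hyt⟩
    rwa [hf, Set.indicator_of_mem hys] at hy

/-- Mollifications stay uniformly bounded and converge in `L_p` by dominated convergence; for
uniformly bounded functions this forces convergence in the Morrey norm. -/
lemma boundedFun_subset_diamondMorrey {u p : ℝ} (hp : 1 ≤ p) (hpu : p ≤ u) :
    boundedFun n ⊆ diamondMorrey (unitCube n) u p := by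
  rintro b ⟨t, ht⟩
  have hp0 : 0 < p := by linarith
  have hu0 : 0 < u := by linarith
  refine ⟨(morreyLENorm_le_const hp0 hu0 ht).trans_lt ENNReal.coe_lt_top, fun δ hδ => ?_⟩
  obtain ⟨g, hgs, hgc, hgt, hlim⟩ := exists_smooth_approx b.stronglyMeasurable ht
  have hgm : ∀ k, AEStronglyMeasurable (g k) (volume.restrict (unitCube n)) :=
    fun k => (hgs k).continuous.aestronglyMeasurable
  have hbd : ∀ k, ∀ᵐ y ∂volume.restrict (unitCube n), ‖b y - g k y‖ₑ ≤ 2 * t := by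
    intro k
    filter_upwards [ht] with y hy
    refine enorm_sub_le.trans ?_
    rw [two_mul]
    exact add_le_add hy (enorm_le_coe_iff_norm_le.2 (hgt k y))
  have h1 : Tendsto (fun k => ∫⁻ y in unitCube n, ‖b y - g k y‖ₑ ^ p) atTop (𝓝 0) := by
    have := tendsto_lintegral_of_dominated_convergence' (μ := volume.restrict (unitCube n))
      (F := fun k y => ‖b y - g k y‖ₑ ^ p) (f := fun _ => 0) (fun _ => (2 * t : ℝ≥0∞) ^ p)
      (fun k => ((b.aestronglyMeasurable.sub (hgm k)).enorm).pow_const p)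
      (fun k => (hbd k).mono fun y hy => ENNReal.rpow_le_rpow hy hp0.le) ?_ ?_
    · simpa using this
    · rw [lintegral_const, measure_univ, mul_one]
      exact ENNReal.rpow_ne_top_of_nonneg hp0.le (by finiteness)
    · filter_upwards [hlim] with y hy
      have h2 : Tendsto (fun k => ‖b y - g k y‖ₑ) atTop (𝓝 0) := by
        simpa using ((tendsto_const_nhds (x := b y)).sub hy).enorm
      exact tendsto_rpow_zero h2 hp0
  have h2 : Tendsto (fun k => (2 * t : ℝ≥0∞) ^ (1 - p / u) *
      (∫⁻ y in unitCube n, ‖b y - g k y‖ₑ ^ p) ^ (1 / u)) atTop (𝓝 0) := by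
    have h3 : Tendsto (fun k => (∫⁻ y in unitCube n, ‖b y - g k y‖ₑ ^ p) ^ (1 / u)) atTop
        (𝓝 0) := tendsto_rpow_zero h1 (one_div_pos.2 hu0)
    simpa using ENNReal.Tendsto.const_mul h3 (Or.inr (ENNReal.rpow_ne_top_of_nonneg
      (by rw [sub_nonneg, div_le_one hu0]; exact hpu) (by finiteness)))
  obtain ⟨k, hk⟩ := (h2.eventually_lt_const hδ).exists
  refine ⟨AEEqFun.mk (g k) (hgm k), mem_smoothMorrey_of_hasCompactSupport hp0 hu0 (hgs k) (hgc k)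
    (AEEqFun.coeFn_mk _ _), ?_⟩
  refine lt_of_le_of_lt ?_ hk
  rw [morreyENorm_congr (g := fun y => b y - g k y) hp0]
  · exact morreyLENorm_le_of_bounded hp0 hu0 hpu (hbd k) le_rfl
  · filter_upwards [AEEqFun.coeFn_sub b (AEEqFun.mk (g k) (hgm k)), AEEqFun.coeFn_mk (g k) (hgm k)]
      with y h3 h4
    rw [h3, Pi.sub_apply, h4]

lemma diamondMorrey_eq_closureIn_boundedFun {u p : ℝ} (hp : 1 ≤ p) (hpu : p ≤ u) :
    diamondMorrey (unitCube n) u p = closureIn (morreyENorm (unitCube n) u p) (boundedFun n) := by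
  refine Set.Subset.antisymm ?_
    (closureIn_subset_closureIn (morreyENorm_add_le hp) (boundedFun_subset_diamondMorrey hp hpu))
  rintro f ⟨hf, h⟩
  exact ⟨hf, fun δ hδ => (h δ hδ).imp fun g hg => ⟨smoothMorrey_subset_boundedFun hp hg.1, hg.2⟩⟩

end DiamondClosure

/-! ### The interpolation space is contained in the diamond closure -/

section Upper

lemma summable_two_rpow_neg_mul_abs {δ : ℝ} (hδ : 0 < δ) :
    Summable fun k : ℤ => (2 : ℝ) ^ (-δ * |(k : ℝ)|) := by
  have h0 : (2 : ℝ) ^ (-δ) < 1 := Real.rpow_lt_one_of_one_lt_of_neg (by norm_num) (by linarith)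
  have h : Summable fun k : ℕ => ((2 : ℝ) ^ (-δ)) ^ k :=
    summable_geometric_of_lt_one (by positivity) h0
  refine Summable.of_nat_of_neg ?_ ?_
  all_goals
    refine h.congr fun k => ?_
    rw [← Real.rpow_natCast, ← Real.rpow_mul (by norm_num)]
    simp

/-- If `c i ≤ min (2 ^ (i Θ) A) (2 ^ (-i (1 - Θ)) B)` on `F`, then
`∑ c i ≤ K A ^ (1 - Θ) B ^ Θ`. -/
lemma exists_sum_le_rpow_mul_rpow {Θ : ℝ} (hΘ₀ : 0 < Θ) (hΘ₁ : Θ < 1) :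
    ∃ K : ℝ, 0 < K ∧ ∀ (F : Finset ℤ) (c : ℤ → ℝ) (A B : ℝ), 0 ≤ A → 0 ≤ B →
      (∀ i ∈ F, c i ≤ 2 ^ (i * Θ) * A) → (∀ i ∈ F, c i ≤ 2 ^ (-(i * (1 - Θ))) * B) →
      ∑ i ∈ F, c i ≤ K * (A ^ (1 - Θ) * B ^ Θ) := by
  set δ := min Θ (1 - Θ) with hδdef
  have hδ : 0 < δ := lt_min hΘ₀ (by linarith)
  have hsum := summable_two_rpow_neg_mul_abs hδ
  have hpos : 0 < ∑' k : ℤ, (2 : ℝ) ^ (-δ * |(k : ℝ)|) :=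
    hsum.tsum_pos (fun k => by positivity) 0 (by positivity)
  refine ⟨2 * ∑' k : ℤ, (2 : ℝ) ^ (-δ * |(k : ℝ)|), by positivity, fun F c A B hA hB h₁ h₂ => ?_⟩
  -- If `A` or `B` vanishes, every `c i` is nonpositive; this case is split off to take logarithms.
  rcases hA.eq_or_lt with rfl | hA
  · refine (Finset.sum_nonpos fun i hi => by simpa using h₁ i hi).trans (by positivity)
  rcases hB.eq_or_lt with rfl | hB
  · refine (Finset.sum_nonpos fun i hi => by simpa using h₂ i hi).trans (by positivity)
  set α := Real.logb 2 A
  set β := Real.logb 2 B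
  have hα : A = 2 ^ α := (Real.rpow_logb (by norm_num) (by norm_num) hA).symm
  have hβ : B = 2 ^ β := (Real.rpow_logb (by norm_num) (by norm_num) hB).symm
  -- The two bounds cross at `i = β - α`, with common value `A ^ (1 - Θ) * B ^ Θ`, and decay
  -- geometrically away from it; the factor 2 pays for rounding.
  set m := ⌊β - α⌋
  have hm₁ : (m : ℝ) ≤ β - α := Int.floor_le _
  have hm₂ : β - α < m + 1 := Int.lt_floor_add_one _
  have hterm : ∀ i ∈ F, c i ≤ 2 * (A ^ (1 - Θ) * B ^ Θ) * 2 ^ (-δ * |((i - m : ℤ) : ℝ)|) := by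
    intro i hi
    have h₁' := h₁ i hi
    have h₂' := h₂ i hi
    rw [hα, ← Real.rpow_add two_pos] at h₁'
    rw [hβ, ← Real.rpow_add two_pos] at h₂'
    rw [hα, hβ, ← Real.rpow_mul zero_le_two, ← Real.rpow_mul zero_le_two,
      ← Real.rpow_add two_pos]
    nth_rewrite 1 [← Real.rpow_one 2]
    rw [← Real.rpow_add two_pos, ← Real.rpow_add two_pos]
    have hδ₁ : δ ≤ Θ := min_le_left _ _
    have hδ₂ : δ ≤ 1 - Θ := min_le_right _ _
    push_cast
    rcases le_total (i : ℝ) m with him | him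
    · refine h₁'.trans (Real.rpow_le_rpow_of_exponent_le one_le_two ?_)
      rw [abs_of_nonpos (by linarith)]
      nlinarith
    · refine h₂'.trans (Real.rpow_le_rpow_of_exponent_le one_le_two ?_)
      rw [abs_of_nonneg (by linarith)]
      nlinarith
  have hsum' : Summable fun i : ℤ => (2 : ℝ) ^ (-δ * |((i - m : ℤ) : ℝ)|) :=
    (Equiv.subRight m).summable_iff.2 hsum
  have htsum : ∑' i : ℤ, (2 : ℝ) ^ (-δ * |((i - m : ℤ) : ℝ)|) =
      ∑' k : ℤ, (2 : ℝ) ^ (-δ * |(k : ℝ)|) :=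
    (Equiv.subRight m).tsum_eq fun k : ℤ => (2 : ℝ) ^ (-δ * |(k : ℝ)|)
  refine (Finset.sum_le_sum hterm).trans ?_
  rw [← Finset.mul_sum, ← htsum]
  calc _ ≤ 2 * (A ^ (1 - Θ) * B ^ Θ) * ∑' i : ℤ, (2 : ℝ) ^ (-δ * |((i - m : ℤ) : ℝ)|) := by
        gcongr
        exact hsum'.sum_le_tsum F fun i _ => by positivity
    _ = _ := by ring

/-- The weight of the `i`-th term in the `j`-th space of the Peetre–Gagliardo method. -/
def gagliardoWeight (Θ : ℝ) (j : Fin 2) (i : ℤ) : ℂ :=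
  (((2 : ℝ) ^ ((i : ℝ) * (((j : ℕ) : ℝ) - Θ)) : ℝ) : ℂ)

lemma nnnorm_gagliardoWeight (Θ : ℝ) (j : Fin 2) (i : ℤ) :
    ‖gagliardoWeight Θ j i‖₊ = (2 : ℝ≥0) ^ ((i : ℝ) * (((j : ℕ) : ℝ) - Θ)) := by
  apply NNReal.coe_injective
  rw [gagliardoWeight, coe_nnnorm, Complex.norm_real, Real.norm_of_nonneg (by positivity)]
  simp

lemma exists_sum_enorm_le {Θ : ℝ} (hΘ₀ : 0 < Θ) (hΘ₁ : Θ < 1) :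
    ∃ K : ℝ≥0, 0 < K ∧ ∀ (F : Finset ℤ) (b : ℤ → ℂ), ∑ i ∈ F, ‖b i‖ₑ ≤
      K * ((F.sup fun i => ‖gagliardoWeight Θ 0 i * b i‖ₑ) ^ (1 - Θ) *
        (F.sup fun i => ‖gagliardoWeight Θ 1 i * b i‖ₑ) ^ Θ) := by
  obtain ⟨K, hK, h⟩ := exists_sum_le_rpow_mul_rpow hΘ₀ hΘ₁
  lift K to ℝ≥0 using hK.le
  refine ⟨K, NNReal.coe_pos.1 hK, fun F b => ?_⟩
  have h1 : 0 ≤ 1 - Θ := by linarith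
  simp only [enorm_eq_nnnorm, ← ENNReal.coe_finset_sup]
  rw [← ENNReal.coe_rpow_of_nonneg _ h1, ← ENNReal.coe_rpow_of_nonneg _ hΘ₀.le]
  norm_cast
  rw [← NNReal.coe_le_coe]
  push_cast
  refine h F (fun i => ‖b i‖) _ _ (NNReal.coe_nonneg _) (NNReal.coe_nonneg _) (fun i hi => ?_)
    fun i hi => ?_
  · have h3 := NNReal.coe_le_coe.2 (Finset.le_sup (f := fun i => ‖gagliardoWeight Θ 0 i * b i‖₊) hi)
    simp only [nnnorm_mul, nnnorm_gagliardoWeight] at h3 ⊢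
    push_cast at h3 ⊢
    calc ‖b i‖ = 2 ^ (i * Θ) * (2 ^ ((i : ℝ) * (0 - Θ)) * ‖b i‖) := by
          rw [← mul_assoc, ← Real.rpow_add two_pos]; ring_nf; simp
      _ ≤ _ := by gcongr; simpa using h3
  · have h3 := NNReal.coe_le_coe.2 (Finset.le_sup (f := fun i => ‖gagliardoWeight Θ 1 i * b i‖₊) hi)
    simp only [nnnorm_mul, nnnorm_gagliardoWeight] at h3 ⊢
    push_cast at h3 ⊢
    calc ‖b i‖ = 2 ^ (-(i * (1 - Θ))) * (2 ^ ((i : ℝ) * (1 - Θ)) * ‖b i‖) := by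
          rw [← mul_assoc, ← Real.rpow_add two_pos]; ring_nf; simp
      _ ≤ _ := by gcongr; simpa using h3

end Upper

/-! ### Partial sums of Peetre–Gagliardo representations -/

section Series

variable {Y : Type*} [AddCommGroup Y] {N : Y → ℝ≥0∞}

/-- The Cauchy criterion for unconditional convergence: the sum over `S` is the difference of two
late partial sums. -/
lemma SeriesConvergesTo.exists_sum_le (hsub : ∀ f g, N (f - g) ≤ N f + N g) {y : ℤ → Y} {s : Y}
    (h : SeriesConvergesTo N y s) {δ : ℝ≥0∞} (hδ : 0 < δ) :
    ∃ F : Finset ℤ, ∀ S : Finset ℤ, Disjoint F S → N (∑ i ∈ S, y i) ≤ δ := by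
  obtain ⟨F, hF⟩ := eventually_atTop.1 (h.2.eventually_lt_const (ENNReal.half_pos hδ.ne'))
  refine ⟨F, fun S hS => ?_⟩
  calc N (∑ i ∈ S, y i) = N ((s - ∑ i ∈ F, y i) - (s - ∑ i ∈ F ∪ S, y i)) := by
        rw [Finset.sum_union hS]; congr 1; abel
    _ ≤ _ := hsub _ _
    _ ≤ δ / 2 + δ / 2 :=
      add_le_add (hF F le_rfl).le (hF (F ∪ S) Finset.subset_union_left).le
    _ = δ := ENNReal.add_halves δ

/-- Partial sums are eventually constant. Since `N` need not separate points, this yields a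
comparison of norms rather than `s = ∑ i ∈ S, y i`. -/
lemma SeriesConvergesTo.sum_le_of_support (hsub : ∀ f g, N (f - g) ≤ N f + N g) {y : ℤ → Y} {s : Y}
    (h : SeriesConvergesTo N y s) {S : Finset ℤ} (hS : ∀ i ∉ S, y i = 0) :
    N (∑ i ∈ S, y i) ≤ N s := by
  refine ENNReal.le_of_forall_pos_le_add fun δ hδ _ => ?_
  obtain ⟨F, hF⟩ := eventually_atTop.1 (h.2.eventually_lt_const (ENNReal.coe_pos.2 hδ))
  have h1 : ∑ i ∈ F ∪ S, y i = ∑ i ∈ S, y i :=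
    (Finset.sum_subset Finset.subset_union_right fun i _ hi => hS i hi).symm
  calc N (∑ i ∈ S, y i) = N (s - (s - ∑ i ∈ F ∪ S, y i)) := by rw [h1]; congr 1; abel
    _ ≤ _ := hsub _ _
    _ ≤ N s + δ := by gcongr; exact (hF (F ∪ S) Finset.subset_union_left).le

variable [Module ℂ Y]

/-- Take for `ε` the indicator of `S`. -/
lemma IsPeetreGagliardoRepr.sum_le {N : Fin 2 → Y → ℝ≥0∞} {Θ : ℝ} {a : Y} {x : ℤ → Y} {C : ℝ≥0}
    (h : IsPeetreGagliardoRepr N Θ a x C) (hsub : ∀ j f g, N j (f - g) ≤ N j f + N j g)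
    (j : Fin 2) (S : Finset ℤ) : N j (∑ i ∈ S, gagliardoWeight Θ j i • x i) ≤ C := by
  classical
  have hε : (⨆ i, ‖(if i ∈ S then 1 else 0 : ℂ)‖ₑ) ≤ 1 :=
    iSup_le fun i => by split_ifs <;> simp
  obtain ⟨s, hs, hsC⟩ := h.2.2 (fun i => if i ∈ S then 1 else 0)
    (hε.trans_lt ENNReal.one_lt_top) j
  have h1 := hs.sum_le_of_support (hsub j) (S := S) fun i hi => by simp [hi]
  have h2 : ∑ i ∈ S, gagliardoWeight Θ j i • x i =
      ∑ i ∈ S, ((if i ∈ S then 1 else 0 : ℂ) *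
        (((2 : ℝ) ^ ((i : ℝ) * (((j : ℕ) : ℝ) - Θ)) : ℝ) : ℂ)) • x i :=
    Finset.sum_congr rfl fun i hi => by simp [hi, gagliardoWeight]
  rw [h2]
  calc _ ≤ N j s := h1
    _ ≤ C * (⨆ i, ‖(if i ∈ S then 1 else 0 : ℂ)‖ₑ) := hsC
    _ ≤ C * 1 := by gcongr
    _ = C := mul_one _

/-- The constant sequence `ε = 1` suffices, because convergence along finite sets is already
unconditional. The union of the two sets `F j` serves both spaces. -/
lemma IsPeetreGagliardoRepr.exists_sum_le {N : Fin 2 → Y → ℝ≥0∞} {Θ : ℝ} {a : Y} {x : ℤ → Y}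
    {C : ℝ≥0} (h : IsPeetreGagliardoRepr N Θ a x C) (hsub : ∀ j f g, N j (f - g) ≤ N j f + N j g)
    {δ : ℝ≥0∞} (hδ : 0 < δ) : ∃ F : Finset ℤ, ∀ S : Finset ℤ, Disjoint F S → ∀ j,
      N j (∑ i ∈ S, gagliardoWeight Θ j i • x i) ≤ δ := by
  have h1 : ∀ j, ∃ F : Finset ℤ, ∀ S : Finset ℤ, Disjoint F S →
      N j (∑ i ∈ S, gagliardoWeight Θ j i • x i) ≤ δ := by
    intro j
    obtain ⟨s, hs, -⟩ := h.2.2 (fun _ => 1) (by simp) j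
    obtain ⟨F, hF⟩ := hs.exists_sum_le (hsub j) hδ
    exact ⟨F, fun S hS => by simpa [gagliardoWeight] using hF S hS⟩
  choose F hF using h1
  refine ⟨Finset.univ.biUnion F, fun S hS j => hF j S ?_⟩
  exact hS.mono_left (Finset.subset_biUnion_of_mem F (Finset.mem_univ j))

end Series

/-! ### From representations to limits of bounded functions -/

section MorreyUpper

variable {n : ℕ}

local notation "Y" => EuclideanSpace ℝ (Fin n) →ₘ[volume.restrict (unitCube n)] ℂ

lemma lintegral_enorm_add_le (f g : Y) :
    ∫⁻ y in unitCube n, ‖(f + g) y‖ₑ ≤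
      (∫⁻ y in unitCube n, ‖f y‖ₑ) + ∫⁻ y in unitCube n, ‖g y‖ₑ := by
  rw [← lintegral_add_left' f.aestronglyMeasurable.enorm]
  refine lintegral_mono_ae ?_
  filter_upwards [AEEqFun.coeFn_add f g] with y hy
  rw [hy]
  exact enorm_add_le _ _

/-- Both end spaces embed in `L¹` of the cube, so convergence in the sum space identifies limits in
`L¹`. -/
lemma lintegral_enorm_le_sumENorm {U P : Fin 2 → ℝ} (hP : ∀ j, 1 ≤ P j) (f : Y) :
    ∫⁻ y in unitCube n, ‖f y‖ₑ ≤
      sumENorm (fun j => morreyENorm (unitCube n) (U j) (P j)) f := by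
  refine le_iInf fun f₀ => le_iInf fun f₁ => le_iInf fun h => ?_
  rw [h]
  exact (lintegral_enorm_add_le f₀ f₁).trans (add_le_add
    (lintegral_unitCube_le (hP 0) f₀.aestronglyMeasurable.enorm)
    (lintegral_unitCube_le (hP 1) f₁.aestronglyMeasurable.enorm))

/-- Lower semicontinuity of the Morrey norm with respect to `L¹`. -/
lemma morreyENorm_le_of_forall_exists {u p : ℝ} (hp : 0 < p) {f : Y} {D : ℝ≥0∞}
    (h : ∀ δ : ℝ≥0∞, 0 < δ → ∃ g : Y, ∫⁻ y in unitCube n, ‖(g - f) y‖ₑ ≤ δ ∧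
      morreyENorm (unitCube n) u p g ≤ D) : morreyENorm (unitCube n) u p f ≤ D := by
  have h' : ∀ k : ℕ, ∃ g : Y, ∫⁻ y in unitCube n, ‖(g - f) y‖ₑ ≤ (k : ℝ≥0∞)⁻¹ ∧
      morreyENorm (unitCube n) u p g ≤ D := fun k => h _ (by simp)
  choose g hg hgD using h'
  refine morreyLENorm_le_of_tendsto hp (fun k => (g k).aestronglyMeasurable)
    f.aestronglyMeasurable ?_ hgD
  refine tendsto_of_tendsto_of_tendsto_of_le_of_le tendsto_const_nhds
    ENNReal.tendsto_inv_nat_nhds_zero (fun _ => bot_le) fun k => le_trans (le_of_eq ?_) (hg k)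
  refine lintegral_congr_ae ?_
  filter_upwards [AEEqFun.coeFn_sub (g k) f] with y hy
  rw [hy, Pi.sub_apply]

lemma morreyENorm_sum_smul_eq {u p : ℝ} (hp : 0 < p) (S : Finset ℤ) (c : ℤ → ℂ) (x : ℤ → Y) :
    morreyENorm (unitCube n) u p (∑ i ∈ S, c i • x i) =
      morreyLENorm u p fun y => ‖∑ i ∈ S, c i * x i y‖ₑ := by
  refine morreyENorm_congr hp ?_
  filter_upwards [AEEqFun.coeFn_fun_finsetSum S fun i => c i • x i,
    (Finset.eventually_all S).2 fun i _ => AEEqFun.coeFn_smul (c i) (x i)] with y h1 h2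
  rw [h1]
  exact Finset.sum_congr rfl fun i hi => by rw [h2 i hi, Pi.smul_apply, smul_eq_mul]

/-- The key estimate: partial sums are controlled in the intermediate Morrey space by the
weighted partial sums in the endpoint spaces. -/
lemma exists_morreyENorm_sum_le {Θ p u : ℝ} {P U : Fin 2 → ℝ} (hΘ₀ : 0 < Θ) (hΘ₁ : Θ < 1)
    (hp : 1 ≤ p) (hP : ∀ j, 1 ≤ P j) (hκ : ∀ j, P j / U j = p / u)
    (hpp : 1 / p = (1 - Θ) / P 0 + Θ / P 1) :
    ∃ K : ℝ≥0, 0 < K ∧ ∀ (x : ℤ → Y) (D : ℝ≥0∞) (F : Finset ℤ),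
      (∀ j, ∀ S ⊆ F, morreyENorm (unitCube n) (U j) (P j)
        (∑ i ∈ S, gagliardoWeight Θ j i • x i) ≤ D) →
      morreyENorm (unitCube n) u p (∑ i ∈ F, x i) ≤ K * D := by
  obtain ⟨K, hK, hsum⟩ := exists_sum_enorm_le hΘ₀ hΘ₁
  have h1 : 0 ≤ 1 - Θ := by linarith
  have hp0 : 0 < p := by linarith
  refine ⟨K * 2, by positivity, fun x D F h => ?_⟩
  have hm : ∀ j i, AEStronglyMeasurable (fun y => gagliardoWeight Θ j i * x i y)
      (volume.restrict (unitCube n)) := fun j i => (x i).aestronglyMeasurable.const_mul _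
  have hsup : ∀ j, morreyLENorm (U j) (P j)
      (fun y => F.sup fun i => ‖gagliardoWeight Θ j i * x i y‖ₑ) ≤ 2 * D := fun j =>
    morreyLENorm_finset_sup_le (hP j) F (hm j) fun S hS => by
      rw [← morreyENorm_sum_smul_eq (by linarith [hP j])]
      exact h j S hS
  have hsm : ∀ j, AEMeasurable (fun y => F.sup fun i => ‖gagliardoWeight Θ j i * x i y‖ₑ)
      (volume.restrict (unitCube n)) := fun j => by
    simp_rw [Finset.sup_eq_iSup]
    exact .iSup fun i => .iSup fun _ => (hm j i).enorm
  calc morreyENorm (unitCube n) u p (∑ i ∈ F, x i)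
      = morreyLENorm u p fun y => ‖∑ i ∈ F, x i y‖ₑ := by
        simpa using morreyENorm_sum_smul_eq hp0 F (fun _ => 1) x
    _ ≤ morreyLENorm u p fun y => K *
          ((F.sup fun i => ‖gagliardoWeight Θ 0 i * x i y‖ₑ) ^ (1 - Θ) *
            (F.sup fun i => ‖gagliardoWeight Θ 1 i * x i y‖ₑ) ^ Θ) :=
        morreyLENorm_mono_ae hp0 (ae_of_all _ fun y =>
          (enorm_sum_le _ _).trans (hsum F fun i => x i y))
    _ ≤ K * ((2 * D) ^ (1 - Θ) * (2 * D) ^ Θ) := by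
        refine (morreyLENorm_const_mul_le hp0 K _).trans ?_
        gcongr
        refine (morreyLENorm_mul_rpow_le hΘ₀.le hΘ₁.le hp0 (by linarith [hP 0])
          (by linarith [hP 1]) (hκ 0) (hκ 1) hpp (hsm 0) (hsm 1)).trans ?_
        gcongr
        · exact hsup 0
        · exact hsup 1
    _ = ↑(K * 2) * D := by
        rw [← ENNReal.rpow_add_of_nonneg _ _ h1 hΘ₀.le, sub_add_cancel, ENNReal.rpow_one,
          ENNReal.coe_mul, mul_assoc]
        rfl

/-- The estimate for finite sums is applied to `(F ∪ G) \ F`, where `G` is so large that this sum is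
`L¹`-close to `a - ∑ i ∈ F, x i`; lower semicontinuity passes to the limit. The empty `F` gives the
norm bound, a large `F` the approximation. -/
lemma exists_morreyENorm_le_of_repr {Θ p u : ℝ} {P U : Fin 2 → ℝ} (hΘ₀ : 0 < Θ) (hΘ₁ : Θ < 1)
    (hp : 1 ≤ p) (hP : ∀ j, 1 ≤ P j) (hκ : ∀ j, P j / U j = p / u)
    (hpp : 1 / p = (1 - Θ) / P 0 + Θ / P 1) :
    ∃ K : ℝ≥0, 0 < K ∧ ∀ (a : Y) (x : ℤ → Y) (C : ℝ≥0),
      IsPeetreGagliardoRepr (fun j => morreyENorm (unitCube n) (U j) (P j)) Θ a x C →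
      morreyENorm (unitCube n) u p a ≤ K * C ∧
      ∀ δ : ℝ≥0∞, 0 < δ → ∃ F : Finset ℤ,
        morreyENorm (unitCube n) u p (a - ∑ i ∈ F, x i) ≤ K * δ := by
  obtain ⟨K, hK, hKle⟩ := exists_morreyENorm_sum_le (n := n) hΘ₀ hΘ₁ hp hP hκ hpp
  have hp0 : 0 < p := by linarith
  refine ⟨K, hK, fun a x C hrep => ?_⟩
  have hsub : ∀ j f g, morreyENorm (unitCube n) (U j) (P j) (f - g) ≤
      morreyENorm (unitCube n) (U j) (P j) f + morreyENorm (unitCube n) (U j) (P j) g :=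
    fun j => morreyENorm_sub_le (hP j)
  have key : ∀ (F : Finset ℤ) (D : ℝ≥0∞), (∀ S : Finset ℤ, Disjoint F S → ∀ j,
      morreyENorm (unitCube n) (U j) (P j) (∑ i ∈ S, gagliardoWeight Θ j i • x i) ≤ D) →
      morreyENorm (unitCube n) u p (a - ∑ i ∈ F, x i) ≤ K * D := by
    intro F D hD
    refine morreyENorm_le_of_forall_exists hp0 fun δ hδ => ?_
    obtain ⟨G, hG⟩ := eventually_atTop.1 (hrep.2.1.2.eventually_lt_const hδ)
    refine ⟨∑ i ∈ (F ∪ G) \ F, x i, ?_, hKle x D _ fun j S hS => hD S ?_ j⟩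
    · refine (lintegral_congr_ae ?_).trans_le ((lintegral_enorm_le_sumENorm hP _).trans
        (hG (F ∪ G) Finset.subset_union_right).le)
      have h1 : ∑ i ∈ (F ∪ G) \ F, x i - (a - ∑ i ∈ F, x i) = -(a - ∑ i ∈ F ∪ G, x i) := by
        rw [← Finset.sum_sdiff (Finset.subset_union_left : F ⊆ F ∪ G)]; abel
      rw [h1]
      filter_upwards [AEEqFun.coeFn_neg (a - ∑ i ∈ F ∪ G, x i)] with y hy
      rw [hy, Pi.neg_apply, enorm_neg]
    · exact Finset.disjoint_sdiff.mono_right hS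
  refine ⟨?_, fun δ hδ => ?_⟩
  · simpa using key ∅ C fun S _ j => hrep.sum_le hsub j S
  · obtain ⟨F, hF⟩ := hrep.exists_sum_le hsub hδ
    exact ⟨F, key F δ hF⟩

/-- The restriction of a class of functions to a measurable set, extended by zero. -/
def restrictFun (f : Y) (s : Set (EuclideanSpace ℝ (Fin n))) (hs : MeasurableSet s) : Y :=
  AEEqFun.mk (s.indicator f) (f.stronglyMeasurable.indicator hs).aestronglyMeasurable

lemma coeFn_restrictFun (f : Y) {s : Set (EuclideanSpace ℝ (Fin n))} (hs : MeasurableSet s) :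
    restrictFun f s hs =ᵐ[volume.restrict (unitCube n)] s.indicator f :=
  AEEqFun.coeFn_mk _ _

lemma coeFn_sub_restrictFun (f : Y) {s : Set (EuclideanSpace ℝ (Fin n))} (hs : MeasurableSet s) :
    ⇑(f - restrictFun f s hs) =ᵐ[volume.restrict (unitCube n)] sᶜ.indicator f := by
  filter_upwards [coeFn_restrictFun f hs, AEEqFun.coeFn_sub f (restrictFun f s hs)] with y h1 h2
  rw [h2, Pi.sub_apply, h1, Set.indicator_compl, Pi.sub_apply]

lemma measurableSet_norm_le (f : Y) (t : ℝ≥0) : MeasurableSet {y | ‖f y‖ₑ ≤ t} :=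
  measurableSet_le f.stronglyMeasurable.enorm measurable_const

lemma restrictFun_mem_boundedFun (f : Y) (t : ℝ≥0) :
    restrictFun f {y | ‖f y‖ₑ ≤ t} (measurableSet_norm_le f t) ∈ boundedFun n := by
  refine ⟨t, ?_⟩
  filter_upwards [coeFn_restrictFun f (measurableSet_norm_le f t)] with y hy
  rw [hy]
  by_cases h : y ∈ {y | ‖f y‖ₑ ≤ t}
  · rw [Set.indicator_of_mem h]; exact h
  · rw [Set.indicator_of_notMem h]; simp

/-- If the truncations of `f` at large heights vanish in the Morrey space, then `f` is in the
closure of the bounded functions. -/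
lemma mem_closureIn_boundedFun {u p : ℝ} (hp : 0 < p) {f : Y}
    (hf : morreyENorm (unitCube n) u p f < ∞)
    (h : Tendsto (fun k : ℕ => morreyLENorm u p
      ({y | ‖f y‖ₑ ≤ (k : ℝ≥0)}ᶜ.indicator fun y => ‖f y‖ₑ)) atTop (𝓝 0)) :
    f ∈ closureIn (morreyENorm (unitCube n) u p) (boundedFun n) := by
  refine ⟨hf, fun δ hδ => ?_⟩
  obtain ⟨k, hk⟩ := (h.eventually_lt_const hδ).exists
  refine ⟨_, restrictFun_mem_boundedFun f k, lt_of_le_of_lt (le_of_eq ?_) hk⟩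
  rw [morreyENorm_congr hp (coeFn_sub_restrictFun f _)]
  congr 1
  ext y
  exact enorm_indicator_eq_indicator_enorm _ _

/-- Where `|f| > k`, one has `|f| ≤ k^{-(q/p-1)} |f|^{q/p}`, and the power on the right is
controlled by the stronger norm, so the truncations decay. -/
lemma mem_closureIn_boundedFun_of_lt {u p v q : ℝ} (hp : 1 ≤ p) (hpq : p < q) (hu : 0 < u)
    (hκ : q / v = p / u) {f : Y}
    (hf : morreyENorm (unitCube n) v q f < ∞) :
    f ∈ closureIn (morreyENorm (unitCube n) u p) (boundedFun n) := by
  have hp0 : 0 < p := by linarith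
  have hq0 : 0 < q := by linarith
  refine mem_closureIn_boundedFun hp0 ((morreyLENorm_le_of_le hp0 hpq.le hκ.symm
    (by rw [hκ]; positivity) f.aestronglyMeasurable.enorm).trans_lt hf) ?_
  have hqp : 0 < q / p - 1 := by rw [sub_pos, one_lt_div hp0]; exact hpq
  have hM : morreyENorm (unitCube n) v q f ^ (q / p) ≠ ∞ :=
    ENNReal.rpow_ne_top_of_nonneg (by positivity) hf.ne
  have hlim : Tendsto (fun k : ℕ => ((k : ℝ≥0∞)⁻¹ ^ (q / p - 1)) *
      morreyENorm (unitCube n) v q f ^ (q / p)) atTop (𝓝 0) := by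
    simpa using ENNReal.Tendsto.mul_const
      (tendsto_rpow_zero ENNReal.tendsto_inv_nat_nhds_zero hqp) (Or.inr hM)
  refine tendsto_of_tendsto_of_tendsto_of_le_of_le' tendsto_const_nhds hlim
    (Eventually.of_forall fun _ => bot_le) ?_
  filter_upwards [eventually_ge_atTop 1] with k hk
  have hk0 : (k : ℝ≥0∞) ≠ 0 := by
    have : k ≠ 0 := by omega
    exact_mod_cast this
  set c : ℝ≥0 := (k : ℝ≥0)⁻¹ ^ (q / p - 1) with hc
  have hc' : (c : ℝ≥0∞) = (k : ℝ≥0∞)⁻¹ ^ (q / p - 1) := by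
    rw [hc, ENNReal.coe_rpow_of_nonneg _ hqp.le, ENNReal.coe_inv (by exact_mod_cast hk0)]
    simp
  rw [← hc']
  calc _ ≤ morreyLENorm u p fun y => c * ‖f y‖ₑ ^ (q / p) := by
        refine morreyLENorm_mono_ae hp0 (ae_of_all _ fun y => ?_)
        by_cases hy : y ∈ {y | ‖f y‖ₑ ≤ (k : ℝ≥0)}
        · rw [Set.indicator_of_notMem (by simpa using hy)]; exact bot_le
        · rw [Set.indicator_of_mem hy, hc']
          have hy' : (k : ℝ≥0∞) ≤ ‖f y‖ₑ := by
            simpa using (not_le.1 hy).le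
          have h1 : ‖f y‖ₑ ^ (q / p) = ‖f y‖ₑ ^ (q / p - 1) * ‖f y‖ₑ := by
            conv_rhs => rw [← ENNReal.rpow_one ‖f y‖ₑ, ← ENNReal.rpow_mul, one_mul]
            rw [← ENNReal.rpow_add_of_nonneg _ _ hqp.le zero_le_one, sub_add_cancel]
          rw [h1, ← mul_assoc, ← ENNReal.mul_rpow_of_nonneg _ _ hqp.le]
          have h2 : 1 ≤ (k : ℝ≥0∞)⁻¹ * ‖f y‖ₑ := by
            rw [← ENNReal.inv_mul_cancel hk0 (ENNReal.natCast_ne_top k)]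
            gcongr
          exact le_mul_of_one_le_left bot_le (ENNReal.one_le_rpow h2 hqp)
    _ ≤ _ := (morreyLENorm_const_mul_le hp0 c _).trans (by
        gcongr
        exact morreyLENorm_rpow_le hq0 hp0 hκ.symm _)

/-- If `p = u` the Morrey space is `L_p`, in which bounded functions are dense. -/
lemma mem_closureIn_boundedFun_of_eq {p : ℝ} (hp : 1 ≤ p) {f : Y}
    (hf : morreyENorm (unitCube n) p p f < ∞) :
    f ∈ closureIn (morreyENorm (unitCube n) p p) (boundedFun n) := by
  have hp0 : 0 < p := by linarith
  refine mem_closureIn_boundedFun hp0 hf ?_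
  have hfi : ∫⁻ y in unitCube n, ‖f y‖ₑ ^ p ≠ ∞ :=
    ((lintegral_unitCube_rpow_le hp0 _).trans_lt (ENNReal.rpow_lt_top_of_nonneg hp0.le hf.ne)).ne
  have h1 : Tendsto (fun k : ℕ => ∫⁻ y in unitCube n,
      ({y | ‖f y‖ₑ ≤ (k : ℝ≥0)}ᶜ.indicator (fun y => ‖f y‖ₑ) y) ^ p) atTop (𝓝 0) := by
    have := tendsto_lintegral_of_dominated_convergence' (μ := volume.restrict (unitCube n))
      (F := fun (k : ℕ) y => ({y | ‖f y‖ₑ ≤ (k : ℝ≥0)}ᶜ.indicator (fun y => ‖f y‖ₑ) y) ^ p)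
      (f := fun _ => 0) (fun y => ‖f y‖ₑ ^ p)
      (fun k => ((f.stronglyMeasurable.enorm.indicator
        (measurableSet_norm_le f k).compl).pow_const p).aemeasurable)
      (fun k => ae_of_all _ fun y => ENNReal.rpow_le_rpow (Set.indicator_le_self _ _ y) hp0.le)
      hfi ?_
    · simpa using this
    · refine ae_of_all _ fun y => tendsto_const_nhds.congr' ?_
      filter_upwards [eventually_ge_atTop ⌈‖f y‖₊⌉₊] with k hk
      rw [Set.indicator_of_notMem, ENNReal.zero_rpow_of_pos hp0]
      simp only [Set.mem_compl_iff, not_not, Set.mem_ofPred_eq, enorm_le_coe]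
      exact (Nat.le_ceil _).trans (by exact_mod_cast hk)
  refine tendsto_of_tendsto_of_tendsto_of_le_of_le tendsto_const_nhds
    (tendsto_rpow_zero h1 (one_div_pos.2 hp0)) (fun _ => bot_le) fun k => ?_
  -- No height bound is needed: `A = ∞` enters with exponent `1 - p / p = 0`, and `∞ ^ 0 = 1`.
  have h2 := morreyLENorm_le_of_bounded (n := n) (p := p) (u := p) hp0 hp0 le_rfl (A := ∞)
    (φ := {y | ‖f y‖ₑ ≤ (k : ℝ≥0)}ᶜ.indicator (fun y => ‖f y‖ₑ)) (by simp) le_rfl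
  simpa [hp0.ne'] using h2

/-- Finite partial sums lie in both end spaces and converge to `a` in the middle one. The dichotomy
`p₀ ≠ p₁` or `p₀ = u₀` is needed only to supply `hinter`. -/
lemma mem_closureIn_boundedFun_of_repr {Θ p u : ℝ} {P U : Fin 2 → ℝ} (hΘ₀ : 0 < Θ) (hΘ₁ : Θ < 1)
    (hp : 1 ≤ p) (hP : ∀ j, 1 ≤ P j) (hκ : ∀ j, P j / U j = p / u)
    (hpp : 1 / p = (1 - Θ) / P 0 + Θ / P 1)
    (hinter : ∀ f : Y, (∀ j, morreyENorm (unitCube n) (U j) (P j) f < ∞) →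
      f ∈ closureIn (morreyENorm (unitCube n) u p) (boundedFun n)) {a : Y}
    (ha : a ∈ peetreGagliardo (fun j => morreyENorm (unitCube n) (U j) (P j)) Θ) :
    a ∈ closureIn (morreyENorm (unitCube n) u p) (boundedFun n) := by
  obtain ⟨x, C, hrep⟩ := ha
  obtain ⟨K, hK, h⟩ := exists_morreyENorm_le_of_repr (n := n) hΘ₀ hΘ₁ hp hP hκ hpp
  obtain ⟨h1, h2⟩ := h a x C hrep
  refine closureIn_subset_closureIn (morreyENorm_add_le hp)
    (S := {f | ∀ j, morreyENorm (unitCube n) (U j) (P j) f < ∞}) hinter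
    ⟨h1.trans_lt (by finiteness), fun δ hδ => ?_⟩
  obtain ⟨δ', hδ', hlt⟩ : ∃ δ' : ℝ≥0∞, 0 < δ' ∧ K * δ' < δ := by
    obtain ⟨ε, hε, hεδ⟩ := exists_between hδ
    refine ⟨(K : ℝ≥0∞)⁻¹ * ε, ENNReal.mul_pos (ENNReal.inv_ne_zero.2 ENNReal.coe_ne_top) hε.ne', ?_⟩
    rwa [ENNReal.mul_inv_cancel_left (by exact_mod_cast hK.ne') (by simp)]
  obtain ⟨F, hF⟩ := h2 δ' hδ'
  refine ⟨∑ i ∈ F, x i, fun j => ?_, hF.trans_lt hlt⟩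
  refine Finset.sum_induction x (fun f => morreyENorm (unitCube n) (U j) (P j) f < ∞)
    (fun f g hf hg => (morreyENorm_add_le (hP j) f g).trans_lt (ENNReal.add_lt_top.2 ⟨hf, hg⟩))
    ?_ fun i _ => hrep.1 i j
  rw [morreyENorm_zero (by linarith [hP j])]
  exact ENNReal.zero_lt_top

end MorreyUpper

/-! ### The diamond closure is contained in the interpolation space -/

section MorreyLower

variable {n : ℕ}

local notation "Y" => EuclideanSpace ℝ (Fin n) →ₘ[volume.restrict (unitCube n)] ℂ

/-- The dyadic level of `f` at height scale `R`, with steepness `β`. -/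
def dyadicLevel (f : Y) (R β : ℝ) (y : EuclideanSpace ℝ (Fin n)) : ℤ :=
  ⌊β * Real.logb 2 (‖f y‖ / R)⌋

lemma measurable_dyadicLevel (f : Y) (R β : ℝ) : Measurable (dyadicLevel f R β) :=
  Int.measurable_floor.comp
    (((Real.measurable_log.comp (f.stronglyMeasurable.norm.measurable.div_const R)).div_const
      _).const_mul β)

lemma indicator_le_of_mem {α : Type*} {s : Set α} {φ : α → ℝ≥0∞} {y : α} {a : ℝ≥0∞}
    (h : y ∈ s → φ y ≤ a) : s.indicator φ y ≤ a := by
  by_cases hy : y ∈ s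
  · rw [Set.indicator_of_mem hy]; exact h hy
  · rw [Set.indicator_of_notMem hy]; exact bot_le

/-- If `|b| ≤ t` and `|f| > 2t`, then `|f| ≤ 2 |f - b|`, so an approximation by a bounded `b`
controls the truncation. -/
lemma exists_truncation_le {u p : ℝ} (hp : 0 < p) {f : Y}
    (hf : f ∈ closureIn (morreyENorm (unitCube n) u p) (boundedFun n)) {δ : ℝ≥0∞} (hδ : 0 < δ) :
    ∃ t : ℝ≥0, morreyLENorm u p ({y | (t : ℝ≥0∞) < ‖f y‖ₑ}.indicator fun y => ‖f y‖ₑ) ≤ δ := by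
  obtain ⟨b, ⟨t, ht⟩, hb⟩ := hf.2 (δ / 2) (ENNReal.half_pos hδ.ne')
  refine ⟨2 * t, ?_⟩
  calc _ ≤ morreyLENorm u p fun y => (2 : ℝ≥0) * ‖(f - b) y‖ₑ := by
        refine morreyLENorm_mono_ae hp ?_
        filter_upwards [ht, AEEqFun.coeFn_sub f b] with y hy hsub
        refine indicator_le_of_mem fun hyt => ?_
        rw [hsub, Pi.sub_apply]
        simp only [Set.mem_ofPred_eq, enorm_eq_nnnorm, ENNReal.coe_lt_coe, ENNReal.coe_le_coe]
          at hy hyt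
        rw [enorm_eq_nnnorm, enorm_eq_nnnorm]
        norm_cast
        have h1 : ‖f y‖ ≤ ‖f y - b y‖ + ‖b y‖ := by
          simpa using norm_add_le (f y - b y) (b y)
        have h2 : ‖b y‖ ≤ t := hy
        have h3 : 2 * (t : ℝ) < ‖f y‖ := hyt
        rw [← NNReal.coe_le_coe]
        push_cast
        linarith
    _ ≤ 2 * (δ / 2) := (morreyLENorm_const_mul_le hp 2 _).trans
        (mul_le_mul' (by simp) hb.le)
    _ = δ := ENNReal.mul_div_cancel two_ne_zero (by simp)

/-- For a large range of levels, a point outside it has `|f| > t` or `|f| ≤ e`. The first part is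
small by truncation, the second because a function bounded by `e` has Morrey norm at most `e` on the
unit cube. -/
lemma exists_level_tail_le {u p : ℝ} (hp : 1 ≤ p) (hu : 0 < u) {f : Y}
    (hf : f ∈ closureIn (morreyENorm (unitCube n) u p) (boundedFun n)) {R : ℝ} (hR : 0 < R) (β : ℝ)
    {δ : ℝ≥0∞} (hδ : 0 < δ) :
    ∃ F₀ : Finset ℤ, ∀ F : Finset ℤ, F₀ ⊆ F → morreyLENorm u p
      ({y | dyadicLevel f R β y ∉ F}.indicator fun y => ‖f y‖ₑ) ≤ δ := by
  have hp0 : 0 < p := by linarith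
  obtain ⟨t, ht⟩ := exists_truncation_le hp0 hf (ENNReal.half_pos hδ.ne')
  obtain ⟨e, he0, he⟩ := ENNReal.lt_iff_exists_nnreal_btwn.1 (ENNReal.half_pos hδ.ne')
  have he0' : 0 < (e : ℝ) := by exact_mod_cast he0
  set L : ℤ := ⌈|β| * (|Real.logb 2 (e / R)| + |Real.logb 2 (t / R)|)⌉ + 1
  have hL : |β| * (|Real.logb 2 (e / R)| + |Real.logb 2 (t / R)|) ≤ (L : ℝ) - 1 := by
    have := Int.le_ceil (|β| * (|Real.logb 2 (e / R)| + |Real.logb 2 (t / R)|))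
    simpa [L] using this
  refine ⟨Finset.Icc (-L) L, fun F hF => ?_⟩
  have hpt : ∀ y, {y | dyadicLevel f R β y ∉ F}.indicator (fun y => ‖f y‖ₑ) y ≤
      {y | (t : ℝ≥0∞) < ‖f y‖ₑ}.indicator (fun y => ‖f y‖ₑ) y +
        {y | ‖f y‖ₑ ≤ e}.indicator (fun y => ‖f y‖ₑ) y := by
    intro y
    refine indicator_le_of_mem fun hy => ?_
    by_cases h1 : y ∈ {y | (t : ℝ≥0∞) < ‖f y‖ₑ}
    · rw [Set.indicator_of_mem h1]; exact le_self_add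
    by_cases h2 : y ∈ {y | ‖f y‖ₑ ≤ e}
    · rw [Set.indicator_of_mem h2]; exact le_add_self
    exfalso
    refine hy (hF ?_)
    have h1' : ‖f y‖ ≤ t := enorm_le_coe_iff_norm_le.1 (not_lt.1 h1)
    have h2' : (e : ℝ) < ‖f y‖ := not_le.1 fun h => h2 (enorm_le_coe_iff_norm_le.2 h)
    have h3 : |Real.logb 2 (‖f y‖ / R)| ≤ |Real.logb 2 (e / R)| + |Real.logb 2 (t / R)| := by
      have hlo : Real.logb 2 (e / R) ≤ Real.logb 2 (‖f y‖ / R) :=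
        Real.logb_le_logb_of_le one_lt_two (by positivity) (by gcongr)
      have hhi : Real.logb 2 (‖f y‖ / R) ≤ Real.logb 2 (t / R) :=
        Real.logb_le_logb_of_le one_lt_two (div_pos (he0'.trans h2') hR) (by gcongr)
      rw [abs_le]
      constructor
      · linarith [neg_abs_le (Real.logb 2 (e / R)), abs_nonneg (Real.logb 2 (t / R))]
      · linarith [le_abs_self (Real.logb 2 (t / R)), abs_nonneg (Real.logb 2 (e / R))]
    have h4 : |β * Real.logb 2 (‖f y‖ / R)| ≤ (L : ℝ) - 1 := by
      rw [abs_mul]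
      exact (mul_le_mul_of_nonneg_left h3 (abs_nonneg β)).trans hL
    rw [abs_le] at h4
    rw [Finset.mem_Icc, dyadicLevel]
    constructor
    · rw [Int.le_floor]; push_cast; linarith
    · have := Int.floor_le (β * Real.logb 2 (‖f y‖ / R))
      have h5 : ((⌊β * Real.logb 2 (‖f y‖ / R)⌋ : ℤ) : ℝ) ≤ L := by linarith
      exact_mod_cast h5
  refine (morreyLENorm_mono_ae hp0 (ae_of_all _ hpt)).trans ((morreyLENorm_add_le hp
    (AEMeasurable.indicator f.aestronglyMeasurable.enorm ?_)
    (AEMeasurable.indicator f.aestronglyMeasurable.enorm (measurableSet_norm_le f e))).trans ?_)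
  · exact measurableSet_lt measurable_const f.stronglyMeasurable.enorm
  rw [← ENNReal.add_halves δ]
  refine add_le_add ht ((morreyLENorm_le_const hp0 hu (A := e) (ae_of_all _ fun y => ?_)).trans he.le)
  exact indicator_le_of_mem fun hy => hy

/-- The relation `he` says `1 - e₀ = Θ (e₁ - e₀)` and `1 - e₁ = -(1 - Θ) (e₁ - e₀)`. So if `2^i`
were exactly `z^{e₁ - e₀}`, both inequalities would be equalities without the factor 2, which
absorbs the floor. -/
lemma two_rpow_floor_mul_le {Θ e₀ e₁ z : ℝ} (hΘ₀ : 0 < Θ) (hΘ₁ : Θ < 1)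
    (he : (1 - Θ) * e₀ + Θ * e₁ = 1) (hz : 0 < z) :
    (2 : ℝ) ^ (⌊(e₁ - e₀) * Real.logb 2 z⌋ * (0 - Θ)) * z ≤ 2 * z ^ e₀ ∧
      (2 : ℝ) ^ (⌊(e₁ - e₀) * Real.logb 2 z⌋ * (1 - Θ)) * z ≤ 2 * z ^ e₁ := by
  set s := Real.logb 2 z
  have hzs : z = 2 ^ s := (Real.rpow_logb two_pos (by norm_num) hz).symm
  have h1 := Int.floor_le ((e₁ - e₀) * s)
  have h2 := Int.lt_floor_add_one ((e₁ - e₀) * s)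
  set m := ⌊(e₁ - e₀) * s⌋
  rw [hzs, ← Real.rpow_mul zero_le_two, ← Real.rpow_mul zero_le_two, ← Real.rpow_add two_pos,
    ← Real.rpow_add two_pos]
  have h2' : ∀ a : ℝ, (2 : ℝ) * 2 ^ a = 2 ^ (1 + a) := fun a => by
    rw [Real.rpow_add two_pos, Real.rpow_one]
  rw [h2', h2']
  have hs : s = (1 - Θ) * e₀ * s + Θ * e₁ * s := by rw [← add_mul, he, one_mul]
  constructor <;> refine Real.rpow_le_rpow_of_exponent_le one_le_two ?_
  · nlinarith [mul_le_mul_of_nonneg_left h2.le hΘ₀.le]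
  · nlinarith [mul_le_mul_of_nonneg_left h1 (sub_nonneg.2 hΘ₁.le)]

lemma enorm_gagliardoWeight_mul_le {Θ p : ℝ} {P : Fin 2 → ℝ} (hΘ₀ : 0 < Θ) (hΘ₁ : Θ < 1)
    (hp : 0 < p) (hP : ∀ j, 0 < P j) (hpp : 1 / p = (1 - Θ) / P 0 + Θ / P 1) (f : Y)
    {R : ℝ≥0} (hR : 0 < R) (j : Fin 2) (y : EuclideanSpace ℝ (Fin n)) :
    ‖gagliardoWeight Θ j (dyadicLevel f R (p / P 1 - p / P 0) y) * f y‖ₑ ≤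
      ((2 * R : ℝ≥0) : ℝ≥0∞) * ((R⁻¹ : ℝ≥0) * ‖f y‖ₑ) ^ (p / P j) := by
  have hPj : 0 < p / P j := div_pos hp (hP j)
  rw [enorm_eq_nnnorm, enorm_eq_nnnorm, ← ENNReal.coe_mul, ← ENNReal.coe_rpow_of_nonneg _ hPj.le,
    ← ENNReal.coe_mul, ENNReal.coe_le_coe, nnnorm_mul, nnnorm_gagliardoWeight, ← NNReal.coe_le_coe]
  push_cast
  -- Where `f` vanishes both sides are zero, whatever level the convention `log 0 = 0` assigns.
  rcases (norm_nonneg (f y)).eq_or_lt with h0 | h0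
  · rw [← h0]; simp [Real.zero_rpow hPj.ne']
  have hR' : (0 : ℝ) < R := hR
  have he : (1 - Θ) * (p / P 0) + Θ * (p / P 1) = 1 := by
    have : (1 - Θ) * (p / P 0) + Θ * (p / P 1) = p * ((1 - Θ) / P 0 + Θ / P 1) := by ring
    rw [this, ← hpp, mul_one_div_cancel hp.ne']
  have h := two_rpow_floor_mul_le hΘ₀ hΘ₁ he (div_pos h0 hR')
  rw [show (R : ℝ)⁻¹ * ‖f y‖ = ‖f y‖ / R by ring]
  have hz : ‖f y‖ = R * (‖f y‖ / R) := by field_simp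
  have key : (2 : ℝ) ^ ((dyadicLevel f R (p / P 1 - p / P 0) y : ℝ) * ((j : ℕ) - Θ)) *
      (‖f y‖ / R) ≤ 2 * (‖f y‖ / R) ^ (p / P j) := by
    fin_cases j
    · simpa [dyadicLevel] using h.1
    · simpa [dyadicLevel] using h.2
  calc _ = R * ((2 : ℝ) ^ ((dyadicLevel f R (p / P 1 - p / P 0) y : ℝ) * ((j : ℕ) - Θ)) *
        (‖f y‖ / R)) := by
        conv_lhs => rw [hz]
        ring_nf
    _ ≤ R * (2 * (‖f y‖ / R) ^ (p / P j)) := by gcongr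
    _ = _ := by ring

/-- One estimate serves for single pieces, full sums and tails, according to the choice of `s` and
`c`. The scale `R` keeps the bound linear in the size of `f` despite the power `p / P j`. -/
lemma morreyLENorm_weighted_le {Θ p u : ℝ} {P U : Fin 2 → ℝ} (hΘ₀ : 0 < Θ) (hΘ₁ : Θ < 1)
    (hp : 0 < p) (hP : ∀ j, 0 < P j) (hκ : ∀ j, P j / U j = p / u)
    (hpp : 1 / p = (1 - Θ) / P 0 + Θ / P 1) (f : Y)
    {R : ℝ≥0} (hR : 0 < R) (j : Fin 2) (c : ℤ → ℂ) {B : ℝ≥0} (hc : ∀ i, ‖c i‖ₑ ≤ B)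
    (s : Set (EuclideanSpace ℝ (Fin n))) :
    morreyLENorm (U j) (P j) (s.indicator fun y =>
        ‖c (dyadicLevel f R (p / P 1 - p / P 0) y) *
          gagliardoWeight Θ j (dyadicLevel f R (p / P 1 - p / P 0) y) * f y‖ₑ) ≤
      ((B * (2 * R) : ℝ≥0) : ℝ≥0∞) *
        ((R⁻¹ : ℝ≥0) * morreyLENorm u p (s.indicator fun y => ‖f y‖ₑ)) ^ (p / P j) := by
  have hPj : 0 < p / P j := div_pos hp (hP j)
  calc _ ≤ morreyLENorm (U j) (P j) fun y => ((B * (2 * R) : ℝ≥0) : ℝ≥0∞) *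
          ((R⁻¹ : ℝ≥0) * s.indicator (fun y => ‖f y‖ₑ) y) ^ (p / P j) := by
        refine morreyLENorm_mono_ae (hP j) (ae_of_all _ fun y => ?_)
        refine indicator_le_of_mem fun hy => ?_
        rw [Set.indicator_of_mem hy, mul_assoc, enorm_mul, ENNReal.coe_mul, mul_assoc]
        exact mul_le_mul' (hc _) (enorm_gagliardoWeight_mul_le hΘ₀ hΘ₁ hp hP hpp f hR j y)
    _ ≤ ((B * (2 * R) : ℝ≥0) : ℝ≥0∞) * morreyLENorm (U j) (P j) fun y =>
          ((R⁻¹ : ℝ≥0) * s.indicator (fun y => ‖f y‖ₑ) y) ^ (p / P j) :=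
        morreyLENorm_const_mul_le (hP j) _ _
    _ ≤ _ := by
        gcongr
        refine (morreyLENorm_rpow_le hp (hP j) (hκ j) _).trans ?_
        gcongr
        exact morreyLENorm_const_mul_le hp _ _

lemma measurableSet_dyadicLevel_eq (f : Y) (R β : ℝ) (i : ℤ) :
    MeasurableSet {y | dyadicLevel f R β y = i} :=
  measurable_dyadicLevel f R β (measurableSet_singleton i)

/-- The part of `f` at dyadic level `i`. -/
def levelPart (f : Y) (R β : ℝ) (i : ℤ) : Y :=
  restrictFun f {y | dyadicLevel f R β y = i} (measurableSet_dyadicLevel_eq f R β i)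

/-- The class of `y ↦ c (level of f at y) * f y`. -/
def levelMul (f : Y) (R β : ℝ) (c : ℤ → ℂ) : Y :=
  AEEqFun.mk (fun y => c (dyadicLevel f R β y) * f y)
    (((measurable_from_top (f := c)).comp (measurable_dyadicLevel f R β)).aestronglyMeasurable.mul
      f.aestronglyMeasurable)

lemma coeFn_levelMul (f : Y) (R β : ℝ) (c : ℤ → ℂ) :
    levelMul f R β c =ᵐ[volume.restrict (unitCube n)] fun y => c (dyadicLevel f R β y) * f y :=
  AEEqFun.coeFn_mk _ _

/-- The level sets are disjoint, so at each point at most one term of the sum survives. -/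
lemma coeFn_levelMul_sub_sum (f : Y) (R β : ℝ) (c : ℤ → ℂ) (F : Finset ℤ) :
    ⇑(levelMul f R β c - ∑ i ∈ F, c i • levelPart f R β i) =ᵐ[volume.restrict (unitCube n)]
      {y | dyadicLevel f R β y ∉ F}.indicator fun y => c (dyadicLevel f R β y) * f y := by
  filter_upwards [AEEqFun.coeFn_sub (levelMul f R β c) (∑ i ∈ F, c i • levelPart f R β i),
    coeFn_levelMul f R β c, AEEqFun.coeFn_fun_finsetSum F fun i => c i • levelPart f R β i,
    (Finset.eventually_all F).2 fun i _ => AEEqFun.coeFn_smul (c i) (levelPart f R β i),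
    (Finset.eventually_all F).2 fun i _ =>
      coeFn_restrictFun f (measurableSet_dyadicLevel_eq f R β i)] with y h1 h2 h3 h4 h5
  have h6 : ∑ i ∈ F, (c i • levelPart f R β i : Y) y =
      ∑ i ∈ F, if dyadicLevel f R β y = i then c i * f y else 0 := by
    refine Finset.sum_congr rfl fun i hi => ?_
    rw [h4 i hi, Pi.smul_apply, levelPart, h5 i hi, Set.indicator_apply]
    simp
  rw [h1, Pi.sub_apply, h2, h3, h6, Finset.sum_ite_eq]
  by_cases hy : dyadicLevel f R β y ∈ F <;> simp [hy]

lemma sumENorm_le {N : Fin 2 → Y → ℝ≥0∞} (hN : ∀ j, N j 0 = 0) (j : Fin 2) (h : Y) :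
    sumENorm N h ≤ N j h := by
  fin_cases j
  · exact iInf_le_of_le h (iInf_le_of_le 0 (iInf_le_of_le (by simp) (by simp [hN 1])))
  · exact iInf_le_of_le 0 (iInf_le_of_le h (iInf_le_of_le (by simp) (by simp [hN 0])))

/-- The sum of the weighted series is written down explicitly as a level-dependent multiple of `f`,
and its tails are multiples of `f` on the remaining levels. The assumption `hj` embeds the middle
space in one end space, whence convergence in the sum space. -/
lemma isPeetreGagliardoRepr_levelPart {Θ p u : ℝ} {P U : Fin 2 → ℝ} (hΘ₀ : 0 < Θ) (hΘ₁ : Θ < 1)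
    (hp : 1 ≤ p) (hu : 0 < u) (hP : ∀ j, 0 < P j) (hκ : ∀ j, P j / U j = p / u)
    (hpp : 1 / p = (1 - Θ) / P 0 + Θ / P 1) (hj : ∃ j, P j ≤ p) {f : Y}
    (hf : f ∈ closureIn (morreyENorm (unitCube n) u p) (boundedFun n))
    {R : ℝ≥0} (hR : 0 < R) (hfR : morreyENorm (unitCube n) u p f ≤ R) :
    IsPeetreGagliardoRepr (fun j => morreyENorm (unitCube n) (U j) (P j)) Θ f
      (levelPart f R (p / P 1 - p / P 0)) (2 * R) := by
  have hp0 : 0 < p := by linarith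
  set β := p / P 1 - p / P 0 with hβ
  have hPj : ∀ j, 0 < p / P j := fun j => div_pos hp0 (hP j)
  have hle : ∀ s : Set (EuclideanSpace ℝ (Fin n)),
      morreyLENorm u p (s.indicator fun y => ‖f y‖ₑ) ≤ R := fun s =>
    (morreyLENorm_mono_ae hp0 (ae_of_all _ fun y => Set.indicator_le_self s _ y)).trans hfR
  have hbd : ∀ (j : Fin 2) (s : Set (EuclideanSpace ℝ (Fin n))),
      ((R⁻¹ : ℝ≥0) * morreyLENorm u p (s.indicator fun y => ‖f y‖ₑ)) ^ (p / P j) ≤ 1 := by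
    intro j s
    refine ENNReal.rpow_le_one ?_ (hPj j).le
    calc _ ≤ ((R⁻¹ : ℝ≥0) : ℝ≥0∞) * R := by gcongr; exact hle s
      _ = 1 := by rw [← ENNReal.coe_mul, inv_mul_cancel₀ hR.ne', ENNReal.coe_one]
  have htail : Tendsto (fun F : Finset ℤ => morreyLENorm u p
      ({y | dyadicLevel f R β y ∉ F}.indicator fun y => ‖f y‖ₑ)) atTop (𝓝 0) := by
    rw [ENNReal.tendsto_nhds_zero]
    intro δ hδ
    obtain ⟨F₀, hF₀⟩ := exists_level_tail_le hp hu hf (NNReal.coe_pos.2 hR) β hδ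
    exact eventually_atTop.2 ⟨F₀, hF₀⟩
  have hind : ∀ (s : Set (EuclideanSpace ℝ (Fin n))) (φ : EuclideanSpace ℝ (Fin n) → ℂ),
      (fun y => ‖s.indicator φ y‖ₑ) = s.indicator fun y => ‖φ y‖ₑ := fun s φ => by
    ext y; exact enorm_indicator_eq_indicator_enorm _ _
  refine ⟨fun i j => ?_, ?_, fun ε hε j => ?_⟩
  · have hw : gagliardoWeight Θ j i ≠ 0 := by
      rw [← nnnorm_ne_zero_iff, nnnorm_gagliardoWeight]
      exact (NNReal.rpow_pos two_pos).ne'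
    -- Choosing `c` as the inverse weight recovers the unweighted piece.
    have h1 := morreyLENorm_weighted_le hΘ₀ hΘ₁ hp0 hP hκ hpp f hR j
      (fun _ => (gagliardoWeight Θ j i)⁻¹) (B := ‖(gagliardoWeight Θ j i)⁻¹‖₊) (fun _ => le_rfl)
      {y | dyadicLevel f R β y = i}
    have h2 : morreyENorm (unitCube n) (U j) (P j) (levelPart f R β i) ≤
        ((‖(gagliardoWeight Θ j i)⁻¹‖₊ * (2 * R) : ℝ≥0) : ℝ≥0∞) * 1 := by
      refine le_trans (le_of_eq ?_) (h1.trans (mul_le_mul_right (hbd j _) _))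
      rw [levelPart, morreyENorm_congr (hP j) (coeFn_restrictFun f (measurableSet_dyadicLevel_eq f R β i)),
        hind]
      congr 1
      refine Set.indicator_congr fun y hy => ?_
      rw [Set.mem_ofPred_eq] at hy
      rw [← hβ, hy, inv_mul_cancel₀ hw, one_mul]
    exact h2.trans_lt (by finiteness)
  · obtain ⟨j, hj⟩ := hj
    have hs : ∀ h : Y, sumENorm (fun j => morreyENorm (unitCube n) (U j) (P j)) h ≤
        morreyENorm (unitCube n) u p h := fun h =>
      (sumENorm_le (fun j => morreyENorm_zero (hP j)) j h).trans
        (morreyLENorm_le_of_le (hP j) hj (hκ j) (by positivity) h.aestronglyMeasurable.enorm)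
    refine ⟨(hs f).trans_lt hf.1, ?_⟩
    refine tendsto_of_tendsto_of_tendsto_of_le_of_le tendsto_const_nhds htail (fun _ => bot_le)
      fun F => (hs _).trans (le_of_eq ?_)
    rw [← hind]
    refine morreyENorm_congr hp0 ?_
    have h1 : levelMul f R β (fun _ => 1) = f := by
      refine AEEqFun.ext ?_
      filter_upwards [coeFn_levelMul f R β fun _ => 1] with y hy
      rw [hy, one_mul]
    have h2 := coeFn_levelMul_sub_sum f R β (fun _ => 1) F
    simpa only [h1, one_smul, one_mul] using h2
  · set B := (⨆ i, ‖ε i‖ₑ).toNNReal with hB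
    have hBc : (B : ℝ≥0∞) = ⨆ i, ‖ε i‖ₑ := ENNReal.coe_toNNReal hε.ne
    have hεB : ∀ i, ‖ε i‖ₑ ≤ B := fun i => by rw [hBc]; exact le_iSup (fun i => ‖ε i‖ₑ) i
    have hw := morreyLENorm_weighted_le hΘ₀ hΘ₁ hp0 hP hκ hpp f hR j ε hεB
    rw [← hβ] at hw
    have hNs : morreyENorm (unitCube n) (U j) (P j)
        (levelMul f R β fun i => ε i * gagliardoWeight Θ j i) ≤ (2 * R : ℝ≥0) * ⨆ i, ‖ε i‖ₑ := by
      rw [morreyENorm_congr (hP j) (coeFn_levelMul f R β _), ← hBc, mul_comm]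
      have h1 := hw Set.univ
      simp only [Set.indicator_univ] at h1
      refine h1.trans ?_
      have h2 := hbd j Set.univ
      simp only [Set.indicator_univ] at h2
      rw [ENNReal.coe_mul B]
      exact (mul_le_mul_right h2 _).trans_eq (mul_one _)
    refine ⟨levelMul f R β fun i => ε i * gagliardoWeight Θ j i, ⟨?_, ?_⟩, hNs⟩
    · exact hNs.trans_lt (ENNReal.mul_lt_top ENNReal.coe_lt_top hε)
    · have hlim : Tendsto (fun F : Finset ℤ => ((B * (2 * R) : ℝ≥0) : ℝ≥0∞) *
          ((R⁻¹ : ℝ≥0) * morreyLENorm u p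
            ({y | dyadicLevel f R β y ∉ F}.indicator fun y => ‖f y‖ₑ)) ^ (p / P j))
          atTop (𝓝 0) := by
        have h1 := ENNReal.Tendsto.const_mul htail
          (Or.inr (ENNReal.coe_ne_top (r := R⁻¹)))
        rw [mul_zero] at h1
        simpa using ENNReal.Tendsto.const_mul (tendsto_rpow_zero h1 (hPj j))
          (Or.inr (ENNReal.coe_ne_top (r := B * (2 * R))))
      refine tendsto_of_tendsto_of_tendsto_of_le_of_le tendsto_const_nhds hlim (fun _ => bot_le)
        fun F => le_trans (le_of_eq ?_) (hw {y | dyadicLevel f R β y ∉ F})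
      rw [← hind]
      exact morreyENorm_congr (hP j)
        (coeFn_levelMul_sub_sum f R β (fun i => ε i * gagliardoWeight Θ j i) F)

end MorreyLower

/-! ### Equality of the spaces and the upper norm bound -/

section Main

variable {n : ℕ}

lemma peetreGagliardoENorm_le_of_closure {Θ p u : ℝ} {P U : Fin 2 → ℝ} (hΘ₀ : 0 < Θ) (hΘ₁ : Θ < 1)
    (hp : 1 ≤ p) (hu : 0 < u) (hP : ∀ j, 0 < P j) (hκ : ∀ j, P j / U j = p / u)
    (hpp : 1 / p = (1 - Θ) / P 0 + Θ / P 1) (hj : ∃ j, P j ≤ p)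
    {f : EuclideanSpace ℝ (Fin n) →ₘ[volume.restrict (unitCube n)] ℂ}
    (hf : f ∈ closureIn (morreyENorm (unitCube n) u p) (boundedFun n)) :
    peetreGagliardoENorm (fun j => morreyENorm (unitCube n) (U j) (P j)) Θ f ≤
      (2 : ℝ≥0) * morreyENorm (unitCube n) u p f := by
  refine ENNReal.le_of_forall_pos_le_add fun ε hε _ => ?_
  -- The scale must be positive even when the norm of `f` is zero; `ε / 2` costs `ε` in the constant
  -- `2 * R`.
  set R : ℝ≥0 := (morreyENorm (unitCube n) u p f).toNNReal + ε / 2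
  have hRf : ((morreyENorm (unitCube n) u p f).toNNReal : ℝ≥0∞) = morreyENorm (unitCube n) u p f :=
    ENNReal.coe_toNNReal hf.1.ne
  have hrep := isPeetreGagliardoRepr_levelPart hΘ₀ hΘ₁ hp hu hP hκ hpp hj hf (R := R)
    (by positivity) (by rw [ENNReal.coe_add, hRf]; exact le_self_add)
  have h : peetreGagliardoENorm (fun j => morreyENorm (unitCube n) (U j) (P j)) Θ f ≤
      (2 * R : ℝ≥0) := iInf_le_of_le _ (iInf_le_of_le _ (iInf_le_of_le hrep le_rfl))
  refine h.trans_eq ?_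
  rw [ENNReal.coe_mul, ENNReal.coe_add, hRf, mul_add, ← ENNReal.coe_mul,
    mul_div_cancel₀ _ two_ne_zero]

lemma peetreGagliardo_eq_closureIn {Θ p u : ℝ} {P U : Fin 2 → ℝ} (hΘ₀ : 0 < Θ) (hΘ₁ : Θ < 1)
    (hp : 1 ≤ p) (hu : 0 < u) (hP : ∀ j, 1 ≤ P j) (hκ : ∀ j, P j / U j = p / u)
    (hpp : 1 / p = (1 - Θ) / P 0 + Θ / P 1) (hj : ∃ j, P j ≤ p)
    (hinter : ∀ f : EuclideanSpace ℝ (Fin n) →ₘ[volume.restrict (unitCube n)] ℂ,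
      (∀ j, morreyENorm (unitCube n) (U j) (P j) f < ∞) →
      f ∈ closureIn (morreyENorm (unitCube n) u p) (boundedFun n)) :
    peetreGagliardo (fun j => morreyENorm (unitCube n) (U j) (P j)) Θ =
      closureIn (morreyENorm (unitCube n) u p) (boundedFun n) := by
  refine Set.Subset.antisymm
    (fun a ha => mem_closureIn_boundedFun_of_repr hΘ₀ hΘ₁ hp hP hκ hpp hinter ha) fun f hf => ?_
  have hrep := isPeetreGagliardoRepr_levelPart hΘ₀ hΘ₁ hp hu (fun j => by linarith [hP j]) hκ hpp
    hj hf (R := (morreyENorm (unitCube n) u p f).toNNReal + 1) (by positivity)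
    (by rw [ENNReal.coe_add, ENNReal.coe_toNNReal hf.1.ne]; exact le_self_add)
  exact ⟨_, _, hrep⟩

end Main

end

theorem theorem2p34 (n : ℕ) (hn : 1 ≤ n) (Θ p₀ p₁ u₀ u₁ p u : ℝ)
    (hΘ₀ : 0 < Θ) (hΘ₁ : Θ < 1)
    (hp₀ : 1 ≤ p₀) (hpu₀ : p₀ ≤ u₀) (hp₁ : 1 ≤ p₁) (hpu₁ : p₁ ≤ u₁)
    (hu : 1 / u = (1 - Θ) / u₀ + Θ / u₁) (hp : 1 / p = (1 - Θ) / p₀ + Θ / p₁)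
    (hprop : p₀ * u₁ = p₁ * u₀)
    (hnondeg : p₀ ≠ p₁ ∨ p₀ = u₀) :
    peetreGagliardo ![morreyENorm (unitCube n) u₀ p₀, morreyENorm (unitCube n) u₁ p₁] Θ =
        diamondMorrey (unitCube n) u p ∧
      ∃ c C : ℝ≥0, 0 < c ∧ 0 < C ∧ ∀ f ∈ diamondMorrey (unitCube n) u p,
        c * morreyENorm (unitCube n) u p f ≤
            peetreGagliardoENorm
              ![morreyENorm (unitCube n) u₀ p₀, morreyENorm (unitCube n) u₁ p₁] Θ f ∧
          peetreGagliardoENorm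
              ![morreyENorm (unitCube n) u₀ p₀, morreyENorm (unitCube n) u₁ p₁] Θ f ≤
            C * morreyENorm (unitCube n) u p f := by
  have h1Θ : 0 < 1 - Θ := by linarith
  have hp₀' : 0 < p₀ := by linarith
  have hp₁' : 0 < p₁ := by linarith
  have hu₀' : 0 < u₀ := by linarith
  have hu₁' : 0 < u₁ := by linarith
  have hp' : 0 < p := one_div_pos.1 (by rw [hp]; positivity)
  have hu' : 0 < u := one_div_pos.1 (by rw [hu]; positivity)
  have hκ₁ : p₁ / u₁ = p₀ / u₀ := by rw [div_eq_div_iff hu₁'.ne' hu₀'.ne']; exact hprop.symm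
  have hκ₀ : p₀ / u₀ = p / u := by
    have h1 : p / u = p * (1 / u) := by ring
    have h2 : 1 / u = (p₀ / u₀) * (1 / p) := by
      have h3 : 1 / u₁ = (p₀ / u₀) / p₁ := by rw [← hκ₁]; field_simp
      have h4 : 1 / u₀ = (p₀ / u₀) / p₀ := by field_simp
      rw [hu, hp, show (1 - Θ) / u₀ = (1 - Θ) * (1 / u₀) by ring,
        show Θ / u₁ = Θ * (1 / u₁) by ring, h3, h4]
      ring
    rw [h1, h2]; field_simp
  have hp1 : 1 ≤ p := by
    rw [← one_div_le_one_div hp' one_pos, hp]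
    have h2 : (1 - Θ) / p₀ ≤ 1 - Θ := div_le_self h1Θ.le hp₀
    have h3 : Θ / p₁ ≤ Θ := div_le_self hΘ₀.le hp₁
    linarith
  have hpu : p ≤ u := by
    rw [← div_le_one hu', ← hκ₀, div_le_one hu₀']; exact hpu₀
  set P : Fin 2 → ℝ := ![p₀, p₁]
  set U : Fin 2 → ℝ := ![u₀, u₁]
  have hN : ![morreyENorm (unitCube n) u₀ p₀, morreyENorm (unitCube n) u₁ p₁] =
      fun j => morreyENorm (unitCube n) (U j) (P j) := by
    ext j f; fin_cases j <;> rfl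
  have hP : ∀ j, 1 ≤ P j := by
    intro j; fin_cases j; exacts [hp₀, hp₁]
  have hκ : ∀ j, P j / U j = p / u := by
    intro j; fin_cases j; exacts [hκ₀, hκ₁.trans hκ₀]
  have hpp : 1 / p = (1 - Θ) / P 0 + Θ / P 1 := hp
  have h0 : 1 / p - 1 / p₀ = Θ * (1 / p₁ - 1 / p₀) := by rw [hp]; ring
  have h1 : 1 / p - 1 / p₁ = (1 - Θ) * (1 / p₀ - 1 / p₁) := by rw [hp]; ring
  -- `1 / p` is a convex combination, so the smaller of `p₀` and `p₁` is at most `p`; likewise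
  -- below, when they differ, the larger one exceeds `p`.
  have hj : ∃ j, P j ≤ p := by
    rcases le_total p₀ p₁ with h | h
    · refine ⟨0, (one_div_le_one_div hp' hp₀').1 ?_⟩
      have := mul_nonneg hΘ₀.le (sub_nonneg.2 (one_div_le_one_div_of_le hp₀' h))
      linarith
    · refine ⟨1, (one_div_le_one_div hp' hp₁').1 ?_⟩
      have := mul_nonneg h1Θ.le (sub_nonneg.2 (one_div_le_one_div_of_le hp₁' h))
      linarith
  have hinter : ∀ f : EuclideanSpace ℝ (Fin n) →ₘ[volume.restrict (unitCube n)] ℂ,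
      (∀ j, morreyENorm (unitCube n) (U j) (P j) f < ∞) →
      f ∈ closureIn (morreyENorm (unitCube n) u p) (boundedFun n) := by
    intro f hf
    rcases lt_trichotomy p₀ p₁ with h | h | h
    · refine mem_closureIn_boundedFun_of_lt hp1 (q := p₁) ?_ hu' (hκ 1) (hf 1)
      refine (one_div_lt_one_div hp₁' hp').1 ?_
      have := mul_pos h1Θ (sub_pos.2 (one_div_lt_one_div_of_lt hp₀' h))
      linarith
    -- With `p₀ = p₁` the remaining assumption `p₀ = u₀` makes the density 1, so the middle space is
    -- `L_p`.
    · have hpp₀ : p = p₀ := by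
        rw [← h, sub_self, mul_zero, sub_eq_zero] at h0
        simpa using h0
      have hup : u = p := by
        have h2 : p₀ = u₀ := hnondeg.resolve_left (not_not.2 h)
        rw [← h2, div_self hp₀'.ne'] at hκ₀
        exact ((div_eq_one_iff_eq hu'.ne').1 hκ₀.symm).symm
      have h2 : p₀ = u₀ := hnondeg.resolve_left (not_not.2 h)
      have h3 := hf 0
      simp only [U, P, Matrix.cons_val_zero, ← h2, ← hpp₀] at h3
      rw [hup]
      exact mem_closureIn_boundedFun_of_eq hp1 h3
    · refine mem_closureIn_boundedFun_of_lt hp1 (q := p₀) ?_ hu' (hκ 0) (hf 0)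
      refine (one_div_lt_one_div hp₀' hp').1 ?_
      have := mul_pos hΘ₀ (sub_pos.2 (one_div_lt_one_div_of_lt hp₁' h))
      linarith
  rw [hN, diamondMorrey_eq_closureIn_boundedFun hp1 hpu]
  refine ⟨peetreGagliardo_eq_closureIn hΘ₀ hΘ₁ hp1 hu' hP hκ hpp hj hinter, ?_⟩
  obtain ⟨K, hK, hrep⟩ := exists_morreyENorm_le_of_repr (n := n) hΘ₀ hΘ₁ hp1 hP hκ hpp
  refine ⟨K⁻¹, 2, inv_pos.2 hK, two_pos, fun f hf => ⟨?_, ?_⟩⟩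
  · refine le_iInf fun x => le_iInf fun C => le_iInf fun h => ?_
    calc _ ≤ ((K⁻¹ : ℝ≥0) : ℝ≥0∞) * (K * C) := mul_le_mul_right (hrep f x C h).1 _
      _ = C := by rw [← mul_assoc, ← ENNReal.coe_mul, inv_mul_cancel₀ hK.ne', ENNReal.coe_one,
          one_mul]
  · exact peetreGagliardoENorm_le_of_closure hΘ₀ hΘ₁ hp1 hu' (fun j => by linarith [hP j]) hκ hpp
      hj hf
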